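/- **Theorem.** Let $\mathfrak g$ be a complex Lie algebra, let $\mathbf C$ be the trivial $\mathfrak g$-module, and let $\mathfrak s=\mathfrak s(\mathfrak g,\mathbf C)$ be the associated souped-up Lie algebra: the Lie algebra $\mathfrak g\oplus\mathbf C$ with bracket $[g+a,h+b]=[g,h]$, distinguished vector $\mathbf 1=1\in\mathbf C$, and left multiplication of $\mathfrak a=\mathbf C$ on $\mathfrak s$ by scalars. Let $F(\mathfrak s)$ be the infinite free algebra on $\mathfrak s$, i.e. the free complex vector space on $\mathfrak s$ with bilinear products $x\circ_n y=x_ny$, $n\in\mathbf Z$, subject to no further laws (linear relations of $\mathfrak s$ are kept), and put $Dx=x_{-2}\mathbf 1$. An ideal is a subspace closed under left and right multiplication by all elements with respect to all products. Fix an integer $M\ge 0$. For $N\ge 0$ consider the following *vertex algebra relations*, for $u,v\in\mathfrak s$, $x,y,z\in F(\mathfrak s)$, with $m,n$ ranging over $-1$ and all integers $\ge M$ unless otherwise indicated: - $\mathbf 1_nx-\delta_{n+1,0}\,x$; - $u_nv$ for all $n\ge N$; - $D(x_ny)-(Dx)_ny-x_n(Dy)$; - $(Dx)_ny+n\,x_{n-1}y$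 for all $n\in\mathbf Z$; - $x_ny+\sum_{k\ge0}\frac{(-1)^{n+k}}{k!}D^k(y_{n+k}x)$; - $(x_my)_nz-\sum_{k\ge0}\binom mk(-1)^k\bigl(x_{m-k}(y_{n+k}z)-(-1)^m\,y_{m+n-k}(x_kz)\bigr)$. An ideal $J$ is said to contain an infinite series if, whenever all terms of the series of index $k\ge K$ lie in $J$, the sum of the remaining terms lies in $J$ as well. Let $I(\mathfrak s)$ (with $N\equiv 1$) be the smallest ideal of $F(\mathfrak s)$ containing the vertex algebra relations with $N=1$ and the elements $$s_0t-[s,t],\qquad a_{-1}s-as,\qquad (ab)_{-1}x-a_{-1}(b_{-1}x)\qquad(a,b\in\mathbf C,\ s,t\in\mathfrak s,\ x\in F(\mathfrak s)),$$ and let $V(\mathfrak s)=F(\mathfrak s)/I(\mathfrak s)$. Then: 1. the map taking $\mathfrak s$ to its image in $V(\mathfrak s)$ is injective; 2. equivalently, $I(\mathfrak s)\cap\mathfrak s=\{0\}$; 3. $I(\mathfrak s)$ is the ideal of relations of the current algebra of $\mathfrak g$ with vanishing bilinear form $B=0$, that is, the smallest ideal of $F(\mathfrak g\oplus\mathbf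 C)$ containing the vertex algebra relations with $N=2$ and the elements $g_0h-[g,h]$ and $g_1h-B(g,h)\mathbf 1$ for $g,h\in\mathfrak g$. -/

import Mathlib

open scoped BigOperators

/-! ### Infinite free algebras -/

/-- Formal expressions built from vectors of `v` with sums, scalar multiples and binary products
`∘ₙ`, one for every integer `n`. -/
inductive PreIFA (v : Type*) : Type _
  | of : v → PreIFA v
  | add : PreIFA v → PreIFA v → PreIFA v
  | smul : ℂ → PreIFA v → PreIFA v
  | mul : ℤ → PreIFA v → PreIFA v → PreIFA v

/-- The identifications made in the infinite free algebra: the axioms of a complex vector space,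
linearity of the inclusion of `v`, bilinearity of every product, and nothing else. -/
inductive PreIFA.Rel {v : Type*} [AddCommGroup v] [Module ℂ v] : PreIFA v → PreIFA v → Prop
  | of_add (u w : v) : Rel (.of (u + w)) (.add (.of u) (.of w))
  | of_smul (c : ℂ) (u : v) : Rel (.of (c • u)) (.smul c (.of u))
  | add_comm (a b : PreIFA v) : Rel (.add a b) (.add b a)
  | add_assoc (a b c : PreIFA v) : Rel (.add (.add a b) c) (.add a (.add b c))
  | zero_add (a : PreIFA v) : Rel (.add (.of 0) a) a
  | neg_add (a : PreIFA v) : Rel (.add (.smul (-1) a) a) (.of 0)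
  | one_smul (a : PreIFA v) : Rel (.smul 1 a) a
  | mul_smul (c d : ℂ) (a : PreIFA v) : Rel (.smul (c * d) a) (.smul c (.smul d a))
  | smul_add (c : ℂ) (a b : PreIFA v) : Rel (.smul c (.add a b)) (.add (.smul c a) (.smul c b))
  | add_smul (c d : ℂ) (a : PreIFA v) : Rel (.smul (c + d) a) (.add (.smul c a) (.smul d a))
  | mul_add (n : ℤ) (a b c : PreIFA v) :
      Rel (.mul n a (.add b c)) (.add (.mul n a b) (.mul n a c))
  | add_mul (n : ℤ) (a b c : PreIFA v) :
      Rel (.mul n (.add a b) c) (.add (.mul n a c) (.mul n b c))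
  | mul_smul_right (n : ℤ) (c : ℂ) (a b : PreIFA v) :
      Rel (.mul n a (.smul c b)) (.smul c (.mul n a b))
  | mul_smul_left (n : ℤ) (c : ℂ) (a b : PreIFA v) :
      Rel (.mul n (.smul c a) b) (.smul c (.mul n a b))
  | congr_add_left {a a' : PreIFA v} (b : PreIFA v) : Rel a a' → Rel (.add a b) (.add a' b)
  | congr_add_right (a : PreIFA v) {b b' : PreIFA v} : Rel b b' → Rel (.add a b) (.add a b')
  | congr_smul (c : ℂ) {a a' : PreIFA v} : Rel a a' → Rel (.smul c a) (.smul c a')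
  | congr_mul_left (n : ℤ) {a a' : PreIFA v} (b : PreIFA v) :
      Rel a a' → Rel (.mul n a b) (.mul n a' b)
  | congr_mul_right (n : ℤ) (a : PreIFA v) {b b' : PreIFA v} :
      Rel b b' → Rel (.mul n a b) (.mul n a b')

/-- The infinite free algebra `F(v)` generated by a complex vector space `v`: the free complex
vector space with bilinear products `∘ₙ`, `n ∈ ℤ`, satisfying no further laws, on `v`. -/
def IFA (v : Type*) [AddCommGroup v] [Module ℂ v] : Type _ :=
  Quot (PreIFA.Rel (v := v))

namespace IFA

variable {v : Type*} [AddCommGroup v] [Module ℂ v]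

instance : Zero (IFA v) := ⟨Quot.mk _ (.of 0)⟩

instance : Add (IFA v) :=
  ⟨Quot.map₂ .add (fun a _ _ h => .congr_add_right a h) (fun _ _ b h => .congr_add_left b h)⟩

instance : SMul ℂ (IFA v) := ⟨fun c => Quot.map (.smul c) fun _ _ h => .congr_smul c h⟩

instance : Neg (IFA v) := ⟨fun x => (-1 : ℂ) • x⟩

protected theorem add_comm' (x y : IFA v) : x + y = y + x := by
  rcases x with ⟨a⟩; rcases y with ⟨b⟩
  exact Quot.sound (.add_comm a b)

protected theorem zero_add' (x : IFA v) : 0 + x = x := by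
  rcases x with ⟨a⟩
  exact Quot.sound (.zero_add a)

instance : AddCommGroup (IFA v) where
  add_assoc := by
    rintro ⟨a⟩ ⟨b⟩ ⟨c⟩
    exact Quot.sound (.add_assoc a b c)
  zero_add := IFA.zero_add'
  add_zero x := by rw [IFA.add_comm', IFA.zero_add']
  nsmul := nsmulRec
  zsmul := zsmulRec
  neg_add_cancel := by
    rintro ⟨a⟩
    exact Quot.sound (.neg_add a)
  add_comm := IFA.add_comm'

instance : Module ℂ (IFA v) :=
  Module.ofMinimalAxioms
    (by rintro c ⟨a⟩ ⟨b⟩; exact Quot.sound (.smul_add c a b))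
    (by rintro c d ⟨a⟩; exact Quot.sound (.add_smul c d a))
    (by rintro c d ⟨a⟩; exact Quot.sound (.mul_smul c d a))
    (by rintro ⟨a⟩; exact Quot.sound (.one_smul a))

/-- The inclusion of `v` in `F(v)`. -/
def ι : v →ₗ[ℂ] IFA v where
  toFun u := Quot.mk _ (.of u)
  map_add' u w := Quot.sound (.of_add u w)
  map_smul' c u := Quot.sound (.of_smul c u)

/-- The product `x ∘ₙ y`, also written `xₙy`, as a bilinear map. -/
def mul (n : ℤ) : IFA v →ₗ[ℂ] IFA v →ₗ[ℂ] IFA v :=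
  LinearMap.mk₂ ℂ
    (Quot.map₂ (.mul n) (fun a _ _ h => .congr_mul_right n a h)
      (fun _ _ b h => .congr_mul_left n b h))
    (by rintro ⟨a⟩ ⟨b⟩ ⟨c⟩; exact Quot.sound (.add_mul n a b c))
    (by rintro c ⟨a⟩ ⟨b⟩; exact Quot.sound (.mul_smul_left n c a b))
    (by rintro ⟨a⟩ ⟨b⟩ ⟨c⟩; exact Quot.sound (.mul_add n a b c))
    (by rintro c ⟨a⟩ ⟨b⟩; exact Quot.sound (.mul_smul_right n c a b))

/-- Evaluation of formal expressions in a vector space with products indexed by `ℤ`. -/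
def preLift {W : Type*} [AddCommGroup W] [Module ℂ W] (μ : ℤ → W →ₗ[ℂ] W →ₗ[ℂ] W)
    (f : v →ₗ[ℂ] W) : PreIFA v → W
  | .of u => f u
  | .add a b => preLift μ f a + preLift μ f b
  | .smul c a => c • preLift μ f a
  | .mul n a b => μ n (preLift μ f a) (preLift μ f b)

theorem preLift_rel {W : Type*} [AddCommGroup W] [Module ℂ W] (μ : ℤ → W →ₗ[ℂ] W →ₗ[ℂ] W)
    (f : v →ₗ[ℂ] W) {a b : PreIFA v} (h : PreIFA.Rel a b) :
    preLift μ f a = preLift μ f b := by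
  induction h <;> simp_all [preLift, add_comm, add_assoc, mul_smul, add_smul]

/-- The universal property of `F(v)`: a linear map from `v` to a vector space with products
indexed by `ℤ` extends to `F(v)` compatibly with all products. -/
def lift {W : Type*} [AddCommGroup W] [Module ℂ W] (μ : ℤ → W →ₗ[ℂ] W →ₗ[ℂ] W)
    (f : v →ₗ[ℂ] W) : IFA v →ₗ[ℂ] W where
  toFun := Quot.lift (preLift μ f) fun _ _ h => preLift_rel μ f h
  map_add' := by rintro ⟨a⟩ ⟨b⟩; rfl
  map_smul' := by rintro c ⟨a⟩; rfl

theorem lift_ι {W : Type*} [AddCommGroup W] [Module ℂ W] (μ : ℤ → W →ₗ[ℂ] W →ₗ[ℂ] W)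
    (f : v →ₗ[ℂ] W) (u : v) : lift μ f (ι u) = f u := rfl

theorem lift_mul {W : Type*} [AddCommGroup W] [Module ℂ W] (μ : ℤ → W →ₗ[ℂ] W →ₗ[ℂ] W)
    (f : v →ₗ[ℂ] W) (n : ℤ) (x y : IFA v) :
    lift μ f (mul n x y) = μ n (lift μ f x) (lift μ f y) := by
  rcases x with ⟨a⟩; rcases y with ⟨b⟩; rfl

/-- `v` is a subspace of `F(v)`. -/
theorem ι_injective : Function.Injective (ι : v →ₗ[ℂ] IFA v) := fun u w h => by
  simpa [lift_ι] using congrArg (lift (fun _ => 0) LinearMap.id) h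

/-- An ideal of `F(v)`: a subspace absorbing all products on both sides. -/
def IsIdeal (J : Submodule ℂ (IFA v)) : Prop :=
  ∀ (n : ℤ) (x y : IFA v), y ∈ J → mul n x y ∈ J ∧ mul n y x ∈ J

/-! ### Vertex algebra ideals -/

/-- The operator `D x = x ∘₋₂ 𝟏`, where `𝟏 ∈ v` is the distinguished vector `e`. -/
def D (e : v) : IFA v →ₗ[ℂ] IFA v := (mul (-2)).flip (ι e)

/-- The formal series `x + ∑_{k ≥ 0} t k` belongs to the ideal `J`.
The series has infinitely many terms, so it is read modulo `J`: as soon as all its terms from `K`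
on lie in `J`, the remaining finite sum lies in `J`. (For different such `K` the finite sums
differ by elements of `J`.) -/
def SeriesMem (J : Submodule ℂ (IFA v)) (x : IFA v) (t : ℕ → IFA v) : Prop :=
  ∀ K : ℕ, (∀ k, K ≤ k → t k ∈ J) → x + ∑ k ∈ Finset.range K, t k ∈ J

/-- The indices for which relations are imposed: `-1` and all sufficiently large integers,
where "sufficiently large" means at least `M`. -/
def Idx (M : ℕ) (n : ℤ) : Prop := n = -1 ∨ (M : ℤ) ≤ n

/-- `J` is an ideal of `F(v)` containing the identity, locality, derivation, quasi-commutativity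
and quasi-associativity relations, where `v` is a unital vector space with distinguished vector
`e`, locality is governed by `N`, and indices range over `-1` and the integers `≥ M`. -/
structure ContainsVertexRelations (e : v) (N : v → v → ℕ) (M : ℕ)
    (J : Submodule ℂ (IFA v)) : Prop where
  isIdeal : IsIdeal J
  /-- `𝟏ₙx - δ_{n+1,0} x` -/
  identity : ∀ (x : IFA v) (n : ℤ), Idx M n →
    mul n (ι e) x - (if n + 1 = 0 then x else 0) ∈ J
  /-- `uₙw` for `n ≥ N(u,w)` -/
  locality : ∀ (u w : v) (n : ℤ), (N u w : ℤ) ≤ n → mul n (ι u) (ι w) ∈ J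
  /-- `D(xₙy) - (Dx)ₙy - xₙ(Dy)` -/
  derivation : ∀ (x y : IFA v) (n : ℤ), Idx M n →
    D e (mul n x y) - mul n (D e x) y - mul n x (D e y) ∈ J
  /-- `(Dx)ₙy + n xₙ₋₁y`, for all integers `n` -/
  translation : ∀ (x y : IFA v) (n : ℤ),
    mul n (D e x) y + (n : ℂ) • mul (n - 1) x y ∈ J
  /-- `xₙy + ∑ₖ (-1)ⁿ⁺ᵏ/k! Dᵏ(yₙ₊ₖx)` -/
  quasiComm : ∀ (x y : IFA v) (n : ℤ), Idx M n →
    SeriesMem J (mul n x y) fun k =>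
      ((-1 : ℂ) ^ (n + k) / (k.factorial : ℂ)) • ((D e) ^ k) (mul (n + k) y x)
  /-- `(xₘy)ₙz - ∑ₖ C(m,k) (-1)ᵏ (xₘ₋ₖ(yₙ₊ₖz) - (-1)ᵐ yₘ₊ₙ₋ₖ(xₖz))` -/
  quasiAssoc : ∀ (x y z : IFA v) (m n : ℤ), Idx M m → Idx M n →
    SeriesMem J (mul n (mul m x y) z) fun k =>
      -(((Ring.choose m k : ℤ) : ℂ) * (-1 : ℂ) ^ k) •
        (mul (m - k) x (mul (n + k) y z)
          - (-1 : ℂ) ^ m • mul (m + n - k) y (mul k x z))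

end IFA

/-! ### Souped-up Lie algebras -/

/-- The data defining a souped-up Lie algebra `𝔰(𝔤, 𝔞)`: an `𝔞`-module structure on the Lie
algebra `𝔤` and an action of `𝔤` on the commutative algebra `𝔞` by derivations, with
`[g, a h] = [g, a] h + a [g, h]`. -/
structure SoupedUpLieAlgebra (𝔤 𝔞 : Type*) [LieRing 𝔤] [LieAlgebra ℂ 𝔤]
    [CommRing 𝔞] [Algebra ℂ 𝔞] where
  /-- left multiplication `a g` -/
  smul : 𝔞 →ₗ[ℂ] 𝔤 →ₗ[ℂ] 𝔤
  one_smul : ∀ g, smul 1 g = g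
  mul_smul : ∀ a b g, smul (a * b) g = smul a (smul b g)
  /-- the action `[g, a]` -/
  act : 𝔤 →ₗ⁅ℂ⁆ Derivation ℂ 𝔞 𝔞
  lie_smul : ∀ g a h, ⁅g, smul a h⁆ = smul (act g a) h + smul a ⁅g, h⁆
  one_ne_zero : (1 : 𝔞) ≠ 0

namespace SoupedUpLieAlgebra

variable {𝔤 𝔞 : Type*} [LieRing 𝔤] [LieAlgebra ℂ 𝔤] [CommRing 𝔞] [Algebra ℂ 𝔞]

/-- The vector space `𝔤 ⊕ 𝔞` underlying `𝔰(𝔤, 𝔞)`. -/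
def Carrier (_S : SoupedUpLieAlgebra 𝔤 𝔞) : Type _ := 𝔤 × 𝔞

variable (S : SoupedUpLieAlgebra 𝔤 𝔞)

instance : AddCommGroup S.Carrier := inferInstanceAs (AddCommGroup (𝔤 × 𝔞))

instance : Module ℂ S.Carrier := inferInstanceAs (Module ℂ (𝔤 × 𝔞))

/-- The inclusion of `𝔤`. -/
def inG : 𝔤 →ₗ[ℂ] S.Carrier := LinearMap.inl ℂ 𝔤 𝔞

/-- The inclusion of `𝔞`. -/
def inA : 𝔞 →ₗ[ℂ] S.Carrier := LinearMap.inr ℂ 𝔤 𝔞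

/-- The distinguished vector `𝟏`, the unit of `𝔞`. -/
def one : S.Carrier := S.inA 1

/-- The left multiplication of `𝔞` on `𝔰 = 𝔤 ⊕ 𝔞`. -/
def leftMul (a : 𝔞) (s : S.Carrier) : S.Carrier := (S.smul a s.1, a * s.2)

/-- The semidirect sum bracket, with `𝔞` abelian: `[g + a, h + b] = [g, h] + ([g, b] - [h, a])`. -/
instance : Bracket S.Carrier S.Carrier :=
  ⟨fun s t => (⁅s.1, t.1⁆, S.act s.1 t.2 - S.act t.1 s.2)⟩

theorem lie_def (s t : S.Carrier) :
    ⁅s, t⁆ = ((⁅s.1, t.1⁆, S.act s.1 t.2 - S.act t.1 s.2) : 𝔤 × 𝔞) := rfl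

instance : LieRing S.Carrier where
  add_lie x y z := by
    refine Prod.ext (add_lie x.1 y.1 z.1) ?_
    change S.act (x.1 + y.1) z.2 - S.act z.1 (x.2 + y.2) =
      (S.act x.1 z.2 - S.act z.1 x.2) + (S.act y.1 z.2 - S.act z.1 y.2)
    simp only [map_add, Derivation.add_apply]; ring
  lie_add x y z := by
    refine Prod.ext (lie_add x.1 y.1 z.1) ?_
    change S.act x.1 (y.2 + z.2) - S.act (y.1 + z.1) x.2 =
      (S.act x.1 y.2 - S.act y.1 x.2) + (S.act x.1 z.2 - S.act z.1 x.2)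
    simp only [map_add, Derivation.add_apply]; ring
  lie_self x := Prod.ext (lie_self x.1) (sub_self _)
  leibniz_lie x y z := by
    refine Prod.ext (leibniz_lie x.1 y.1 z.1) ?_
    change S.act x.1 (S.act y.1 z.2 - S.act z.1 y.2) - S.act ⁅y.1, z.1⁆ x.2 =
      (S.act ⁅x.1, y.1⁆ z.2 - S.act z.1 (S.act x.1 y.2 - S.act y.1 x.2)) +
        (S.act y.1 (S.act x.1 z.2 - S.act z.1 x.2) - S.act ⁅x.1, z.1⁆ y.2)
    simp only [LieHom.map_lie, Derivation.commutator_apply, map_sub]; ring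

instance : LieAlgebra ℂ S.Carrier where
  lie_smul c x y := by
    refine Prod.ext (_root_.lie_smul c x.1 y.1) ?_
    change S.act x.1 (c • y.2) - S.act (c • y.1) x.2 =
      c • (S.act x.1 y.2 - S.act y.1 x.2)
    simp [smul_sub]

/-! ### The vertex algebra of a souped-up Lie algebra -/

/-- `J` is an ideal of `F(𝔰)` containing the vertex algebra relations together with
the relations expressing the souped-up Lie algebra structure. -/
structure ContainsRelations (N : S.Carrier → S.Carrier → ℕ) (M : ℕ)
    (J : Submodule ℂ (IFA S.Carrier)) : Prop
    extends IFA.ContainsVertexRelations S.one N M J where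
  /-- `s₀t - [s,t]` -/
  lie : ∀ s t : S.Carrier, IFA.mul 0 (IFA.ι s) (IFA.ι t) - IFA.ι ⁅s, t⁆ ∈ J
  /-- `a₋₁s - as` -/
  leftMul : ∀ (a : 𝔞) (s : S.Carrier),
    IFA.mul (-1) (IFA.ι (S.inA a)) (IFA.ι s) - IFA.ι (S.leftMul a s) ∈ J
  /-- `(ab)₋₁x - a₋₁(b₋₁x)` -/
  assoc : ∀ (a b : 𝔞) (x : IFA S.Carrier),
    IFA.mul (-1) (IFA.ι (S.inA (a * b))) x
      - IFA.mul (-1) (IFA.ι (S.inA a)) (IFA.mul (-1) (IFA.ι (S.inA b)) x) ∈ J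

/-- The souped-up vertex algebra ideal `I(𝔰)`: the ideal of `F(𝔰)` generated by the relations,
i.e. the smallest ideal containing them. -/
def vertexIdeal (N : S.Carrier → S.Carrier → ℕ) (M : ℕ) : Submodule ℂ (IFA S.Carrier) :=
  sInf {J | S.ContainsRelations N M J}

/-- The vertex algebra `V(𝔰) = F(𝔰) / I(𝔰)`. -/
abbrev VertexAlgebra (N : S.Carrier → S.Carrier → ℕ) (M : ℕ) : Type _ :=
  IFA S.Carrier ⧸ S.vertexIdeal N M

/-- The map from `𝔰` to `V(𝔰)`. -/
def toVertexAlgebra (N : S.Carrier → S.Carrier → ℕ) (M : ℕ) :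
    S.Carrier →ₗ[ℂ] S.VertexAlgebra N M :=
  (S.vertexIdeal N M).mkQ ∘ₗ IFA.ι

end SoupedUpLieAlgebra

theorem IFA.SeriesMem.sInf {v : Type*} [AddCommGroup v] [Module ℂ v]
    {𝒥 : Set (Submodule ℂ (IFA v))} {x : IFA v} {t : ℕ → IFA v}
    (h : ∀ J ∈ 𝒥, IFA.SeriesMem J x t) : IFA.SeriesMem (InfSet.sInf 𝒥) x t := by
  intro K hK
  rw [Submodule.mem_sInf]
  exact fun J hJ => h J hJ K fun k hk => (Submodule.mem_sInf.1 (hK k hk)) J hJ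

theorem IFA.ContainsVertexRelations.sInf {v : Type*} [AddCommGroup v] [Module ℂ v]
    {e : v} {N : v → v → ℕ} {M : ℕ} {𝒥 : Set (Submodule ℂ (IFA v))}
    (h : ∀ J ∈ 𝒥, IFA.ContainsVertexRelations e N M J) :
    IFA.ContainsVertexRelations e N M (InfSet.sInf 𝒥) where
  isIdeal n x y hy := by
    simp only [Submodule.mem_sInf] at hy ⊢
    exact ⟨fun J hJ => ((h J hJ).isIdeal n x y (hy J hJ)).1,
      fun J hJ => ((h J hJ).isIdeal n x y (hy J hJ)).2⟩
  identity x n hn := Submodule.mem_sInf.2 fun J hJ => (h J hJ).identity x n hn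
  locality u w n hn := Submodule.mem_sInf.2 fun J hJ => (h J hJ).locality u w n hn
  derivation x y n hn := Submodule.mem_sInf.2 fun J hJ => (h J hJ).derivation x y n hn
  translation x y n := Submodule.mem_sInf.2 fun J hJ => (h J hJ).translation x y n
  quasiComm x y n hn := IFA.SeriesMem.sInf fun J hJ => (h J hJ).quasiComm x y n hn
  quasiAssoc x y z m n hm hn :=
    IFA.SeriesMem.sInf fun J hJ => (h J hJ).quasiAssoc x y z m n hm hn

/-- `I(𝔰)` itself contains the relations, so it is the smallest ideal doing so. -/
theorem SoupedUpLieAlgebra.isLeast_vertexIdeal {𝔤 𝔞 : Type*} [LieRing 𝔤] [LieAlgebra ℂ 𝔤]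
    [CommRing 𝔞] [Algebra ℂ 𝔞] (S : SoupedUpLieAlgebra 𝔤 𝔞)
    (N : S.Carrier → S.Carrier → ℕ) (M : ℕ) :
    IsLeast {J | S.ContainsRelations N M J} (S.vertexIdeal N M) :=
  ⟨{ toContainsVertexRelations :=
      IFA.ContainsVertexRelations.sInf fun _ hJ => hJ.toContainsVertexRelations
     lie := fun s t => Submodule.mem_sInf.2 fun _ hJ => hJ.lie s t
     leftMul := fun a s => Submodule.mem_sInf.2 fun _ hJ => hJ.leftMul a s
     assoc := fun a b x => Submodule.mem_sInf.2 fun _ hJ => hJ.assoc a b x },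
    fun _ hJ => sInf_le hJ⟩

/-! ### The trivial module and current algebras -/

/-- The souped-up Lie algebra `𝔰(𝔤, ℂ)`, with `ℂ` the trivial `𝔤`-module. -/
def SoupedUpLieAlgebra.trivial (𝔤 : Type*) [LieRing 𝔤] [LieAlgebra ℂ 𝔤] :
    SoupedUpLieAlgebra 𝔤 ℂ where
  smul := LinearMap.lsmul ℂ 𝔤
  one_smul g := by simp
  mul_smul a b g := by
    simp only [LinearMap.lsmul_apply]
    exact SemigroupAction.mul_smul a b g
  act := 0
  lie_smul g a h := by simp
  one_ne_zero := _root_.one_ne_zero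

/-- `J` is an ideal of `F(𝔤 ⊕ ℂ)` containing the vertex algebra relations together with
the relations `g₀h = [g,h]`, `g₁h = B(g,h) 𝟏`, `gₙh = 0` (`n ≥ 2`) of the current algebra of `𝔤`
with bilinear form `B`. -/
structure ContainsCurrentRelations {𝔤 : Type*} [LieRing 𝔤] [LieAlgebra ℂ 𝔤]
    (B : LinearMap.BilinForm ℂ 𝔤) (M : ℕ)
    (J : Submodule ℂ (IFA (SoupedUpLieAlgebra.trivial 𝔤).Carrier)) : Prop
    extends IFA.ContainsVertexRelations (SoupedUpLieAlgebra.trivial 𝔤).one (fun _ _ => 2) M J where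
  zeroth : ∀ g h : 𝔤,
    IFA.mul 0 (IFA.ι ((SoupedUpLieAlgebra.trivial 𝔤).inG g))
        (IFA.ι ((SoupedUpLieAlgebra.trivial 𝔤).inG h))
      - IFA.ι ((SoupedUpLieAlgebra.trivial 𝔤).inG ⁅g, h⁆) ∈ J
  first : ∀ g h : 𝔤,
    IFA.mul 1 (IFA.ι ((SoupedUpLieAlgebra.trivial 𝔤).inG g))
        (IFA.ι ((SoupedUpLieAlgebra.trivial 𝔤).inG h))
      - B g h • IFA.ι (SoupedUpLieAlgebra.trivial 𝔤).one ∈ J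

/-- The ideal of relations of the current algebra of `𝔤` with bilinear form `B`. -/
def currentIdeal {𝔤 : Type*} [LieRing 𝔤] [LieAlgebra ℂ 𝔤] (B : LinearMap.BilinForm ℂ 𝔤)
    (M : ℕ) : Submodule ℂ (IFA (SoupedUpLieAlgebra.trivial 𝔤).Carrier) :=
  sInf {J | ContainsCurrentRelations B M J}

/-!
The two ideals agree because the identity relation, although imposed only for the
indices `-1` and `n ≥ M`, forces `𝟏ₙx = 0` for all `n ≠ -1` and `xₙ𝟏 = 0` for all `n ≥ 0`: the
translation relation lets one move between indices at the price of derivatives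
(`one_mul_mem`, `mul_one_mem`). So in `F(𝔤 ⊕ ℂ)` the relations `s₀t = [s,t]`, `sₙt = 0` (`n ≥ 1`)
for `𝔤 ⊕ ℂ` reduce to those for `𝔤`.

Injectivity of `𝔰 → V(𝔰)` requires a model in which the relations hold and no nonzero vector of `𝔰`
dies. Let `U = U(t⁻¹𝔤[t⁻¹])`, made into a module over the loop algebra `𝔤[t,t⁻¹]` by
inducing the trivial module of `𝔤[t]`. To construct this action one needs no basis theorem: `U(A)`,
for a subalgebra `A` of `L` with a complementary subalgebra, carries an action of `L` defined by
the representation of `A` on `Hom(L, U(A))` (`InducedModule.act`). The elements `x tⁿ` become the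
modes of a field `x(z)` on `U`, and evaluating formal expressions in `F(𝔰)` on the fields
`x(z) + c`, with the usual `n`-th products of fields, gives a map whose kernel is the required ideal.

That the kernel satisfies the vertex algebra relations rests on three facts. By Dong's lemma
(`FieldOn.IsLocal.prod_left`) all the fields obtained are mutually local; by Goddard's uniqueness
argument (`FieldOn.IsVertexField.apply_state_eq_zero`) they are determined by their states
`a₋₁ vac`, so that it suffices to check the relations on states; and there quasi-associativity is
the definition of the products of fields, while quasi-commutativity is skew-symmetry
(`FieldOn.IsVertexField.skew_symmetry`), which follows from locality and translation covariance.

Finally `x(z) + c` has state `x t⁻¹ + c` in `U`. Since the brackets of `t⁻¹𝔤[t⁻¹]` lie in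
`t⁻²𝔤[t⁻¹]`, every linear form on `𝔤` extends to a character of `t⁻¹𝔤[t⁻¹]`, hence of `U`; these
characters separate the states, and no Poincaré–Birkhoff–Witt theorem is needed.
-/

open Filter

/-! ### Alternating binomial sums -/

/-- The coefficient `(-1)ᵏ C(n,k)` of `xᵏ` in `(1 - x)ⁿ`, for an integer `n`. -/
noncomputable def altChoose (n : ℤ) (k : ℕ) : ℂ := ((Ring.choose n k : ℤ) : ℂ) * (-1 : ℂ) ^ k

theorem altChoose_zero (n : ℤ) : altChoose n 0 = 1 := by simp [altChoose]

theorem altChoose_succ_succ (n : ℤ) (k : ℕ) :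
    altChoose (n + 1) (k + 1) = altChoose n (k + 1) - altChoose n k := by
  simp only [altChoose, Ring.choose_succ_succ]; push_cast; ring

theorem succ_mul_altChoose_succ (n : ℤ) (k : ℕ) :
    ((k : ℂ) + 1) * altChoose n (k + 1) = -(((n : ℂ) - k) * altChoose n k) := by
  have h := Ring.choose_smul_choose n (Nat.le_succ k)
  simp only [Nat.succ_eq_add_one, Nat.choose_succ_self_right, Nat.add_sub_cancel_left,
    Ring.choose_one_right, nsmul_eq_mul] at h
  have h' : ((k : ℂ) + 1) * ((Ring.choose n (k + 1) : ℤ) : ℂ)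
      = ((Ring.choose n k : ℤ) : ℂ) * ((n : ℂ) - k) := by exact_mod_cast h
  simp only [altChoose, pow_succ]
  linear_combination (-(-1 : ℂ) ^ k) * h'

theorem altChoose_nat_of_lt (n k : ℕ) (h : n < k) : altChoose n k = 0 := by
  simp [altChoose, Ring.choose_natCast, Nat.choose_eq_zero_of_lt h]

theorem altChoose_neg_one (k : ℕ) : altChoose (-1) k = 1 := by
  induction k with
  | zero => exact altChoose_zero _
  | succ k ih =>
    have h := altChoose_succ_succ (-1) k
    rw [ih, show (-1 : ℤ) + 1 = ((0 : ℕ) : ℤ) by norm_num,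
      altChoose_nat_of_lt 0 (k + 1) (by omega)] at h
    linear_combination -h

theorem altChoose_neg_two (k : ℕ) : altChoose (-2) k = k + 1 := by
  induction k with
  | zero => simp [altChoose_zero]
  | succ k ih =>
    have h := altChoose_succ_succ (-2) k
    rw [ih, show (-2 : ℤ) + 1 = -1 by norm_num, altChoose_neg_one] at h
    push_cast
    linear_combination -h

section AltSum

variable {V : Type*} [AddCommGroup V] [Module ℂ V]

/-- The sum `∑ₖ (-1)ᵏ C(n,k) f(k)` of an eventually vanishing sequence `f`. -/
noncomputable def altSum (n : ℤ) (f : ℕ → V) : V := ∑ᶠ k, altChoose n k • f k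

theorem altSum_eq_sum_range (n : ℤ) {f : ℕ → V} {K : ℕ} (h : ∀ k, K ≤ k → f k = 0) :
    altSum n f = ∑ k ∈ Finset.range K, altChoose n k • f k := by
  refine finsum_eq_finsetSum_of_support_subset _ fun k hk => ?_
  by_contra hk'
  simp only [Finset.coe_range, Set.mem_Iio, not_lt] at hk'
  exact hk (by simp [h k hk'])

theorem altSum_zero (n : ℤ) : altSum n (fun _ => (0 : V)) = 0 := by simp [altSum]

theorem altSum_add (n : ℤ) {f g : ℕ → V} (hf : ∀ᶠ k in atTop, f k = 0)
    (hg : ∀ᶠ k in atTop, g k = 0) :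
    altSum n (fun k => f k + g k) = altSum n f + altSum n g := by
  obtain ⟨K, hK⟩ := eventually_atTop.1 (hf.and hg)
  rw [altSum_eq_sum_range n (K := K) fun k hk => (hK k hk).1,
    altSum_eq_sum_range n (K := K) fun k hk => (hK k hk).2,
    altSum_eq_sum_range n (K := K) fun k hk => by simp [hK k hk], ← Finset.sum_add_distrib]
  simp

theorem altSum_map (n : ℤ) {f : ℕ → V} (hf : ∀ᶠ k in atTop, f k = 0) {W : Type*}
    [AddCommGroup W] [Module ℂ W] (φ : V →ₗ[ℂ] W) :
    altSum n (fun k => φ (f k)) = φ (altSum n f) := by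
  obtain ⟨K, hK⟩ := eventually_atTop.1 hf
  rw [altSum_eq_sum_range n (K := K) hK,
    altSum_eq_sum_range n (K := K) fun k hk => by simp [hK k hk]]
  simp

theorem altSum_smul (n : ℤ) (c : ℂ) {f : ℕ → V} (hf : ∀ᶠ k in atTop, f k = 0) :
    altSum n (fun k => c • f k) = c • altSum n f :=
  altSum_map n hf (LinearMap.lsmul ℂ V c)

theorem altSum_sub (n : ℤ) {f g : ℕ → V} (hf : ∀ᶠ k in atTop, f k = 0)
    (hg : ∀ᶠ k in atTop, g k = 0) :
    altSum n (fun k => f k - g k) = altSum n f - altSum n g := by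
  have h := altSum_add n hf (g := fun k => (-1 : ℂ) • g k) (hg.mono fun k hk => by simp [hk])
  rw [altSum_smul n _ hg] at h
  simpa [sub_eq_add_neg] using h

/-- Pascal's rule. -/
theorem altSum_succ (n : ℤ) {f : ℕ → V} (hf : ∀ᶠ k in atTop, f k = 0) :
    altSum (n + 1) f = altSum n f - altSum n fun k => f (k + 1) := by
  obtain ⟨K, hK⟩ := eventually_atTop.1 hf
  rw [altSum_eq_sum_range (n + 1) (K := K + 1) fun k hk => hK k (by omega),
    altSum_eq_sum_range n (K := K + 1) fun k hk => hK k (by omega),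
    altSum_eq_sum_range n (K := K) fun k hk => hK (k + 1) (by omega),
    Finset.sum_range_succ', Finset.sum_range_succ', altChoose_zero, altChoose_zero,
    add_sub_right_comm, ← Finset.sum_sub_distrib]
  simp only [altChoose_succ_succ, sub_smul]

/-- The identity `(k + 1) C(n,k+1) = (n - k) C(n,k)`, summed. -/
theorem altSum_nat_smul (n : ℤ) {f : ℕ → V} (hf : ∀ᶠ k in atTop, f k = 0) :
    altSum n (fun k => (k : ℂ) • f k) = -altSum n fun k => ((n : ℂ) - k) • f (k + 1) := by
  obtain ⟨K, hK⟩ := eventually_atTop.1 hf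
  rw [altSum_eq_sum_range n (K := K + 1) fun k hk => by simp [hK k (by omega)],
    altSum_eq_sum_range n (K := K) fun k hk => by simp [hK (k + 1) (by omega)],
    Finset.sum_range_succ', ← Finset.sum_neg_distrib]
  simp only [Nat.cast_zero, zero_smul, smul_zero, add_zero, smul_smul, ← neg_smul]
  refine Finset.sum_congr rfl fun k _ => ?_
  congr 1
  push_cast
  linear_combination succ_mul_altChoose_succ n k

end AltSum

/-! ### Fields and their products -/

section Fields

variable (V : Type*) [AddCommGroup V] [Module ℂ V]

/-- Fields on `V`: families of modes `aₙ ∈ End V` such that, for every `v`, `aₙ v = 0` for all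
large `n`. -/
def FieldOn : Submodule ℂ (ℤ → Module.End ℂ V) where
  carrier := {a | ∀ v, ∀ᶠ n in atTop, a n v = 0}
  add_mem' ha hb v := by
    filter_upwards [ha v, hb v] with n h₁ h₂
    simp [h₁, h₂]
  zero_mem' v := by simp
  smul_mem' c a ha v := by
    filter_upwards [ha v] with n h
    simp [h]

variable {V}

theorem tendsto_add_natCast (q : ℤ) : Tendsto (fun k : ℕ => q + k) atTop atTop :=
  tendsto_atTop_add_const_left _ _ tendsto_natCast_atTop_atTop

theorem FieldOn.eventually_mode (a : FieldOn V) (q : ℤ) (v : V) :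
    ∀ᶠ k : ℕ in atTop, a.1 (q + k) v = 0 :=
  (tendsto_add_natCast q).eventually (a.2 v)

theorem FieldOn.eventually_comp (b : FieldOn V) (φ : ℕ → Module.End ℂ V) (q : ℤ) (v : V) :
    ∀ᶠ k : ℕ in atTop, φ k (b.1 (q + k) v) = 0 :=
  (FieldOn.eventually_mode b q v).mono fun k hk => by simp [hk]

namespace FieldOn

/-- The vector `∑ₖ (-1)ᵏ C(m,k) (aₚ₊ₘ₋ₖ bₙ₊ₖ v - (-1)ᵐ bₙ₊ₘ₋ₖ aₚ₊ₖ v)`. For `p = 0` this is the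
`n`-th mode of the `m`-th product of `a` and `b`; the family over all `p` and `n` consists of the
coefficients of `(z - w)ᵐ a(z) b(w) - (-w + z)ᵐ b(w) a(z)`, expanded in opposite domains. -/
noncomputable def kernel (m : ℤ) (a b : FieldOn V) (p n : ℤ) (v : V) : V :=
  altSum m (fun k => a.1 (p + m - k) (b.1 (n + k) v)) -
    (-1 : ℂ) ^ m • altSum m (fun k => b.1 (n + m - k) (a.1 (p + k) v))

/-- Multiplication by `z - w` raises the exponent. -/
theorem kernel_succ (m : ℤ) (a b : FieldOn V) (p n : ℤ) (v : V) :
    kernel (m + 1) a b p n v = kernel m a b (p + 1) n v - kernel m a b p (n + 1) v := by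
  have h : (-1 : ℂ) ^ (m + 1) = -(-1 : ℂ) ^ m := by
    rw [zpow_add₀ (by norm_num)]; simp
  simp only [kernel, h]
  rw [altSum_succ _ (eventually_comp b _ _ _), altSum_succ _ (eventually_comp a _ _ _)]
  have e₁ : ∀ k : ℕ, p + (m + 1) - k = p + 1 + m - k := fun k => by ring
  have e₂ : ∀ k : ℕ, p + 1 + m - ((k + 1 : ℕ) : ℤ) = p + m - k := fun k => by push_cast; ring
  have e₃ : ∀ k : ℕ, n + ((k + 1 : ℕ) : ℤ) = n + 1 + k := fun k => by push_cast; ring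
  have e₄ : ∀ k : ℕ, n + (m + 1) - k = n + 1 + m - k := fun k => by ring
  have e₅ : ∀ k : ℕ, n + 1 + m - ((k + 1 : ℕ) : ℤ) = n + m - k := fun k => by push_cast; ring
  have e₆ : ∀ k : ℕ, p + ((k + 1 : ℕ) : ℤ) = p + 1 + k := fun k => by push_cast; ring
  simp only [e₁, e₂, e₃, e₄, e₅, e₆, smul_sub, neg_smul]
  abel

theorem kernel_add_right (m : ℤ) (a b b' : FieldOn V) (p n : ℤ) (v : V) :
    kernel m a (b + b') p n v = kernel m a b p n v + kernel m a b' p n v := by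
  simp only [kernel, Submodule.coe_add, Pi.add_apply, LinearMap.add_apply, map_add]
  rw [altSum_add _ (eventually_comp b _ _ _) (eventually_comp b' _ _ _),
    altSum_add _ (eventually_comp a _ _ _) (eventually_comp a _ _ _), smul_add]
  abel

theorem kernel_add_left (m : ℤ) (a a' b : FieldOn V) (p n : ℤ) (v : V) :
    kernel m (a + a') b p n v = kernel m a b p n v + kernel m a' b p n v := by
  simp only [kernel, Submodule.coe_add, Pi.add_apply, LinearMap.add_apply, map_add]
  rw [altSum_add _ (eventually_comp b _ _ _) (eventually_comp b _ _ _),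
    altSum_add _ (eventually_comp a _ _ _) (eventually_comp a' _ _ _), smul_add]
  abel

theorem kernel_smul_right (m : ℤ) (c : ℂ) (a b : FieldOn V) (p n : ℤ) (v : V) :
    kernel m a (c • b) p n v = c • kernel m a b p n v := by
  simp only [kernel, Submodule.coe_smul, Pi.smul_apply, LinearMap.smul_apply, map_smul]
  rw [altSum_smul _ _ (eventually_comp b _ _ _), altSum_smul _ _ (eventually_comp a _ _ _),
    smul_sub, smul_comm c]

theorem kernel_smul_left (m : ℤ) (c : ℂ) (a b : FieldOn V) (p n : ℤ) (v : V) :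
    kernel m (c • a) b p n v = c • kernel m a b p n v := by
  simp only [kernel, Submodule.coe_smul, Pi.smul_apply, LinearMap.smul_apply, map_smul]
  rw [altSum_smul _ _ (eventually_comp b _ _ _), altSum_smul _ _ (eventually_comp a _ _ _),
    smul_sub, smul_comm c]

theorem kernel_add_vec (m : ℤ) (a b : FieldOn V) (p n : ℤ) (v w : V) :
    kernel m a b p n (v + w) = kernel m a b p n v + kernel m a b p n w := by
  simp only [kernel, map_add]
  rw [altSum_add _ (eventually_comp b _ _ _) (eventually_comp b _ _ _),
    altSum_add _ (eventually_comp a _ _ _) (eventually_comp a _ _ _), smul_add]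
  abel

theorem kernel_smul_vec (m : ℤ) (c : ℂ) (a b : FieldOn V) (p n : ℤ) (v : V) :
    kernel m a b p n (c • v) = c • kernel m a b p n v := by
  simp only [kernel, map_smul]
  rw [altSum_smul _ _ (eventually_comp b _ _ _), altSum_smul _ _ (eventually_comp a _ _ _),
    smul_sub, smul_comm c]

theorem eventually_kernel (m : ℤ) (a b : FieldOn V) (p : ℤ) (v : V) :
    ∀ᶠ n in atTop, kernel m a b p n v = 0 := by
  obtain ⟨K, hK⟩ := eventually_atTop.1 (eventually_mode a p v)
  have h : ∀ᶠ n in atTop, ∀ k ∈ Finset.range K, b.1 (n + m - k) (a.1 (p + k) v) = 0 := by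
    refine (eventually_all_finset _).2 fun k _ => ?_
    have h := (tendsto_atTop_add_const_right atTop (m - k) tendsto_id).eventually
      (b.2 (a.1 (p + k) v))
    simpa [add_sub_assoc] using h
  obtain ⟨L, hL⟩ := eventually_atTop.1 (b.2 v)
  filter_upwards [h, eventually_ge_atTop L] with n hn hnL
  have h₁ : ∀ k : ℕ, b.1 (n + k) v = 0 := fun k => hL _ (by omega)
  rw [kernel, altSum_eq_sum_range m (f := fun k : ℕ => b.1 (n + m - k) (a.1 (p + k) v)) (K := K)
    fun k hk => by simp [hK k hk], Finset.sum_eq_zero fun k hk => by rw [hn k hk, smul_zero]]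
  simp [h₁, altSum_zero]

/-- The `m`-th product of fields,
`(aₘb)ₙ = ∑ₖ (-1)ᵏ C(m,k) (aₘ₋ₖ bₙ₊ₖ - (-1)ᵐ bₘ₊ₙ₋ₖ aₖ)`. -/
noncomputable def prod (m : ℤ) : FieldOn V →ₗ[ℂ] FieldOn V →ₗ[ℂ] FieldOn V :=
  LinearMap.mk₂ ℂ
    (fun a b => ⟨fun n =>
      { toFun := kernel m a b 0 n
        map_add' := kernel_add_vec m a b 0 n
        map_smul' := fun c => kernel_smul_vec m c a b 0 n }, eventually_kernel m a b 0⟩)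
    (fun a a' b => by ext n v; exact kernel_add_left m a a' b 0 n v)
    (fun c a b => by ext n v; exact kernel_smul_left m c a b 0 n v)
    (fun a b b' => by ext n v; exact kernel_add_right m a b b' 0 n v)
    (fun c a b => by ext n v; exact kernel_smul_right m c a b 0 n v)

theorem prod_apply (m : ℤ) (a b : FieldOn V) (n : ℤ) (v : V) :
    (prod m a b).1 n v = kernel m a b 0 n v := rfl

end FieldOn

end Fields

/-! ### Locality and Dong's lemma -/

section Differences

variable {V : Type*} [AddCommGroup V] [Module ℂ V]

/-- Multiplication by `z - w` on the coefficients `F p q` of `z⁻ᵖ⁻¹ w⁻ᑫ⁻¹` of a formal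
distribution in `z` and `w`. -/
def diff : Module.End ℂ (ℤ → ℤ → V) where
  toFun F p q := F (p + 1) q - F p (q + 1)
  map_add' F G := by ext p q; simp only [Pi.add_apply]; abel
  map_smul' c F := by ext p q; simp [smul_sub]

theorem diff_apply (F : ℤ → ℤ → V) (p q : ℤ) : diff F p q = F (p + 1) q - F p (q + 1) := rfl

theorem diff_pow_succ (N : ℕ) (F : ℤ → ℤ → V) : (diff ^ (N + 1)) F = (diff ^ N) (diff F) := by
  rw [pow_succ]; rfl

theorem diff_pow_map {W : Type*} [AddCommGroup W] [Module ℂ W] (φ : V →ₗ[ℂ] W) (N : ℕ)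
    (F : ℤ → ℤ → V) : (diff ^ N) (fun p q => φ (F p q)) = fun p q => φ ((diff ^ N) F p q) := by
  induction N generalizing F with
  | zero => rfl
  | succ N ih =>
    rw [diff_pow_succ, diff_pow_succ, ← ih]
    congr 1; ext p q; simp [diff_apply]

theorem diff_pow_swap (N : ℕ) (F : ℤ → ℤ → V) :
    (diff ^ N) (fun p q => F q p) = fun p q => (-1 : ℂ) ^ N • (diff ^ N) F q p := by
  induction N generalizing F with
  | zero => ext; simp
  | succ N ih =>
    have h : diff (fun p q => F q p) = fun p q => ((-1 : ℂ) • diff F) q p := by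
      ext p q; simp [diff_apply]
    rw [diff_pow_succ, diff_pow_succ, h, ih, map_smul]
    ext p q; simp [pow_succ]

theorem diff_pow_eq_zero_of_le {N N' : ℕ} (h : N ≤ N') {F : ℤ → ℤ → V}
    (hF : (diff ^ N) F = 0) : (diff ^ N') F = 0 := by
  rw [← Nat.sub_add_cancel h, pow_add, Module.End.mul_apply, hF, map_zero]

/-- If `F` has no negative powers of `w`, then neither has `(z - w)ᴺ F`, and the constant terms
in `w` of `(z - w)ᴺ F` and `zᴺ F` agree. -/
theorem diff_pow_right (N : ℕ) {F : ℤ → ℤ → V} (hF : ∀ p q, 0 ≤ q → F p q = 0) (p : ℤ) :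
    (∀ q, 0 ≤ q → (diff ^ N) F p q = 0) ∧ (diff ^ N) F p (-1) = F (p + N) (-1) := by
  induction N generalizing F with
  | zero => exact ⟨fun q hq => hF p q hq, by simp⟩
  | succ N ih =>
    have h : ∀ p q, 0 ≤ q → diff F p q = 0 := fun p q hq => by
      simp [diff_apply, hF _ _ hq, hF _ (q + 1) (by omega)]
    rw [diff_pow_succ]
    refine ⟨(ih h).1, ?_⟩
    rw [(ih h).2, diff_apply, hF _ (-1 + 1) (by norm_num), sub_zero]
    congr 1; push_cast; ring

theorem diff_pow_left (N : ℕ) {F : ℤ → ℤ → V} (hF : ∀ p q, 0 ≤ p → F p q = 0) (q : ℤ) :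
    (∀ p, 0 ≤ p → (diff ^ N) F p q = 0) ∧
      (diff ^ N) F (-1) q = (-1 : ℂ) ^ N • F (-1) (q + N) := by
  have h := diff_pow_right N (F := fun p q => F q p) (fun p q hq => hF q p hq) q
  simp only [diff_pow_swap] at h
  refine ⟨fun p hp => ?_, ?_⟩
  · simpa using h.1 p hp
  · rw [← h.2, smul_smul, ← mul_pow]; simp

/-- Multiplication by `z - w` on the coefficients of a formal distribution in `z`, `w`, `x`. -/
def diff₁₂ : Module.End ℂ (ℤ → ℤ → ℤ → V) where
  toFun F p q r := F (p + 1) q r - F p (q + 1) r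
  map_add' F G := by ext p q r; simp only [Pi.add_apply]; abel
  map_smul' c F := by ext p q r; simp [smul_sub]

/-- Multiplication by `z - x` on the coefficients of a formal distribution in `z`, `w`, `x`. -/
def diff₁₃ : Module.End ℂ (ℤ → ℤ → ℤ → V) where
  toFun F p q r := F (p + 1) q r - F p q (r + 1)
  map_add' F G := by ext p q r; simp only [Pi.add_apply]; abel
  map_smul' c F := by ext p q r; simp [smul_sub]

/-- Multiplication by `w - x` on the coefficients of a formal distribution in `z`, `w`, `x`. -/
def diff₂₃ : Module.End ℂ (ℤ → ℤ → ℤ → V) where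
  toFun F p q r := F p (q + 1) r - F p q (r + 1)
  map_add' F G := by ext p q r; simp only [Pi.add_apply]; abel
  map_smul' c F := by ext p q r; simp [smul_sub]

theorem diff₁₃_apply (F : ℤ → ℤ → ℤ → V) (p q r : ℤ) :
    diff₁₃ F p q r = F (p + 1) q r - F p q (r + 1) := rfl

theorem diff₂₃_apply (F : ℤ → ℤ → ℤ → V) (p q r : ℤ) :
    diff₂₃ F p q r = F p (q + 1) r - F p q (r + 1) := rfl

theorem commute_diff₁₃_diff₁₂ : Commute (diff₁₃ (V := V)) diff₁₂ := by
  ext F p q r; simp [diff₁₂, diff₁₃]; abel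

theorem commute_diff₁₃_diff₂₃ : Commute (diff₁₃ (V := V)) diff₂₃ := by
  ext F p q r; simp [diff₂₃, diff₁₃]; abel

theorem commute_diff₁₂_diff₂₃ : Commute (diff₁₂ (V := V)) diff₂₃ := by
  ext F p q r; simp [diff₁₂, diff₂₃]; abel

theorem diff₂₃_eq : diff₂₃ (V := V) = diff₁₃ + -diff₁₂ := by
  ext F p q r; simp [diff₁₂, diff₁₃, diff₂₃]

theorem diff₂₃_pow_apply (N : ℕ) (F : ℤ → ℤ → ℤ → V) (p : ℤ) :
    (diff₂₃ ^ N) F p = (diff ^ N) (F p) := by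
  induction N generalizing F with
  | zero => rfl
  | succ N ih => rw [pow_succ, Module.End.mul_apply, ih, diff_pow_succ]; rfl

theorem diff₁₃_pow_apply (N : ℕ) (F : ℤ → ℤ → ℤ → V) (p q r : ℤ) :
    (diff₁₃ ^ N) F p q r = (diff ^ N) (fun p r => F p q r) p r := by
  induction N generalizing F with
  | zero => rfl
  | succ N ih => rw [pow_succ, Module.End.mul_apply, ih, diff_pow_succ]; rfl

/-- The identity `w - x = (z - x) - (z - w)` and the binomial theorem: a distribution killed by
`(z - w)ˢ` and by `(z - x)ᴺ (w - x)ᴺ` is killed by a power of `w - x`. -/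
theorem diff₂₃_pow_eq_zero {N s : ℕ} {G : ℤ → ℤ → ℤ → V} (h₁₂ : (diff₁₂ ^ s) G = 0)
    (h : (diff₁₃ ^ N) ((diff₂₃ ^ N) G) = 0) : (diff₂₃ ^ (N + s + N)) G = 0 := by
  have hc : Commute (diff₁₃ (V := V)) (-diff₁₂) :=
    (commute_diff₁₃_diff₁₂ (V := V)).neg_right
  have hp : (diff₂₃ (V := V)) ^ (N + s) = _ :=
    (congrArg (· ^ (N + s)) diff₂₃_eq).trans (hc.add_pow (N + s))
  rw [pow_add, Module.End.mul_apply, hp, LinearMap.sum_apply]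
  refine Finset.sum_eq_zero fun i hi => ?_
  rw [← (Nat.cast_commute ((N + s).choose i) (diff₁₃ ^ i * (-diff₁₂) ^ (N + s - i))).eq,
    Module.End.mul_apply, Module.End.natCast_apply]
  suffices (diff₁₃ ^ i * (-diff₁₂) ^ (N + s - i) : Module.End ℂ (ℤ → ℤ → ℤ → V))
      ((diff₂₃ ^ N) G) = 0 by rw [this, smul_zero]
  rcases le_total N i with hN | hN
  · rw [(hc.pow_pow _ _).eq, ← Nat.sub_add_cancel hN, pow_add, Module.End.mul_apply,
      Module.End.mul_apply, h, map_zero, map_zero]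
  · have hn : (-diff₁₂ (V := V)) ^ (N + s - i) = (-1 : ℂ) ^ (N + s - i) • diff₁₂ ^ (N + s - i) := by
      rw [← smul_pow, neg_one_smul]
    rw [Module.End.mul_apply, hn, LinearMap.smul_apply,
      show N + s - i = (N - i) + s by omega, pow_add diff₁₂, Module.End.mul_apply,
      ← Module.End.mul_apply (diff₁₂ ^ s), (commute_diff₁₂_diff₂₃.pow_pow _ _).eq,
      Module.End.mul_apply, h₁₂]
    simp

/-- `F ↦ ∑ₖ (-1)ᵏ C(n,k) F(p + αₖ, q + βₖ, r)`. -/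
noncomputable def altSumShift (n : ℤ) (α β : ℕ → ℤ) (F : ℤ → ℤ → ℤ → V) : ℤ → ℤ → ℤ → V :=
  fun p q r => altSum n fun k => F (p + α k) (q + β k) r

/-- The sums in `altSumShift` are finite. -/
def ShiftFinite (α β : ℕ → ℤ) (F : ℤ → ℤ → ℤ → V) : Prop :=
  ∀ p q r, ∀ᶠ k in atTop, F (p + α k) (q + β k) r = 0

theorem altSumShift_diff₁₃_pow (n : ℤ) (α β : ℕ → ℤ) (N : ℕ) {F : ℤ → ℤ → ℤ → V}
    (hF : ShiftFinite α β F) : ShiftFinite α β ((diff₁₃ ^ N) F) ∧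
      altSumShift n α β ((diff₁₃ ^ N) F) = (diff₁₃ ^ N) (altSumShift n α β F) := by
  induction N with
  | zero => exact ⟨hF, rfl⟩
  | succ N ih =>
    rw [pow_succ', Module.End.mul_apply, Module.End.mul_apply, ← ih.2]
    have h₁ := fun p q r => ih.1 (p + 1) q r
    have h₂ := fun p q r => ih.1 p q (r + 1)
    have e : ∀ (p : ℤ) k, p + α k + 1 = p + 1 + α k := fun p k => add_right_comm _ _ _
    refine ⟨fun p q r => ?_, ?_⟩
    · filter_upwards [h₁ p q r, h₂ p q r] with k hk₁ hk₂
      rw [diff₁₃_apply, e, hk₁, hk₂, sub_zero]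
    · ext p q r
      simp only [altSumShift, diff₁₃_apply, e]
      exact altSum_sub n (h₁ p q r) (h₂ p q r)

theorem altSumShift_diff₂₃_pow (n : ℤ) (α β : ℕ → ℤ) (N : ℕ) {F : ℤ → ℤ → ℤ → V}
    (hF : ShiftFinite α β F) : ShiftFinite α β ((diff₂₃ ^ N) F) ∧
      altSumShift n α β ((diff₂₃ ^ N) F) = (diff₂₃ ^ N) (altSumShift n α β F) := by
  induction N with
  | zero => exact ⟨hF, rfl⟩
  | succ N ih =>
    rw [pow_succ', Module.End.mul_apply, Module.End.mul_apply, ← ih.2]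
    have h₁ := fun p q r => ih.1 p (q + 1) r
    have h₂ := fun p q r => ih.1 p q (r + 1)
    have e : ∀ (q : ℤ) k, q + β k + 1 = q + 1 + β k := fun p k => add_right_comm _ _ _
    refine ⟨fun p q r => ?_, ?_⟩
    · filter_upwards [h₁ p q r, h₂ p q r] with k hk₁ hk₂
      rw [diff₂₃_apply, e, hk₁, hk₂, sub_zero]
    · ext p q r
      simp only [altSumShift, diff₂₃_apply, e]
      exact altSum_sub n (h₁ p q r) (h₂ p q r)

end Differences

namespace FieldOn

variable {V : Type*} [AddCommGroup V] [Module ℂ V]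

/-- The coefficients of `[a(z), b(w)] v`. -/
def commutator (a b : FieldOn V) (v : V) : ℤ → ℤ → V :=
  fun p q => a.1 p (b.1 q v) - b.1 q (a.1 p v)

/-- Mutual locality: `(z - w)ᴺ [a(z), b(w)] = 0` for some `N`. -/
def IsLocal (a b : FieldOn V) : Prop := ∃ N : ℕ, ∀ v, (diff ^ N) (commutator a b v) = 0

theorem IsLocal.symm {a b : FieldOn V} (h : IsLocal a b) : IsLocal b a := by
  obtain ⟨N, hN⟩ := h
  refine ⟨N, fun v => ?_⟩
  have e : commutator b a v = fun p q => (-(commutator a b v)) q p := by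
    ext p q; simp [commutator]
  rw [e, diff_pow_swap, map_neg, hN]
  ext; simp

theorem IsLocal.add_left {a a' b : FieldOn V} (h : IsLocal a b) (h' : IsLocal a' b) :
    IsLocal (a + a') b := by
  obtain ⟨N, hN⟩ := h
  obtain ⟨N', hN'⟩ := h'
  refine ⟨max N N', fun v => ?_⟩
  have e : commutator (a + a') b v = commutator a b v + commutator a' b v := by
    ext p q; simp only [commutator, Pi.add_apply, Submodule.coe_add, LinearMap.add_apply, map_add]
    abel
  rw [e, map_add, diff_pow_eq_zero_of_le (le_max_left _ _) (hN v),
    diff_pow_eq_zero_of_le (le_max_right _ _) (hN' v), add_zero]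

theorem IsLocal.smul_left {a b : FieldOn V} (c : ℂ) (h : IsLocal a b) : IsLocal (c • a) b := by
  obtain ⟨N, hN⟩ := h
  refine ⟨N, fun v => ?_⟩
  have e : commutator (c • a) b v = c • commutator a b v := by
    ext p q; simp [commutator, smul_sub]
  rw [e, map_smul, hN, smul_zero]

/-- For `n ≥ 0` the two expansions of `(z - w)ⁿ` agree. -/
theorem kernel_natCast (n : ℕ) (a b : FieldOn V) (v : V) :
    (fun p q => kernel n a b p q v) = (diff ^ n) (commutator a b v) := by
  induction n with
  | zero =>
    ext p q
    have h : ∀ f : ℕ → V, altSum (0 : ℤ) f = f 0 := fun f => by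
      rw [altSum, finsum_eq_single _ 0 fun k hk => by
        rw [← Nat.cast_zero, altChoose_nat_of_lt 0 k (by omega), zero_smul], altChoose_zero,
        one_smul]
    simp [kernel, h, commutator]
  | succ n ih =>
    rw [pow_succ', Module.End.mul_apply, ← ih]
    ext p q
    push_cast
    exact kernel_succ _ _ _ _ _ _

/-- The coefficients of `[(z - w)ⁿ a(z) b(w) - (-w + z)ⁿ b(w) a(z), c(x)] v`. -/
noncomputable def kernelCommutator (n : ℤ) (a b c : FieldOn V) (v : V) : ℤ → ℤ → ℤ → V :=
  fun p q r => kernel n a b p q (c.1 r v) - c.1 r (kernel n a b p q v)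

theorem diff₁₂_pow_kernelCommutator (n : ℤ) (a b c : FieldOn V) (v : V) (s : ℕ) :
    (diff₁₂ ^ s) (kernelCommutator n a b c v) = kernelCommutator (n + s) a b c v := by
  induction s with
  | zero => simp
  | succ s ih =>
    rw [pow_succ', Module.End.mul_apply, ih]
    ext p q r
    have h := kernel_succ (n + s) a b
    rw [add_assoc] at h
    simp only [kernelCommutator, diff₁₂, LinearMap.coe_mk, AddHom.coe_mk, Nat.cast_succ, h,
      map_sub]
    abel

/-- The coefficients of `[a(z) b(w), c(x)] v` are killed by `(z - x)ᴺ (w - x)ᴺ`. -/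
theorem diff_pow_commutator_comp {a b c : FieldOn V} {N : ℕ}
    (hac : ∀ v, (diff ^ N) (commutator a c v) = 0) (hbc : ∀ v, (diff ^ N) (commutator b c v) = 0)
    (v : V) : (diff₁₃ ^ N) ((diff₂₃ ^ N)
      fun p q r => a.1 p (b.1 q (c.1 r v)) - c.1 r (a.1 p (b.1 q v))) = 0 := by
  have e : (fun p q r => a.1 p (b.1 q (c.1 r v)) - c.1 r (a.1 p (b.1 q v))) =
      (fun p q r => a.1 p (commutator b c v q r)) +
        fun p q r => commutator a c (b.1 q v) p r := by
    ext p q r; simp [commutator]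
  have h₁ : (diff₂₃ ^ N) (fun p q r => a.1 p (commutator b c v q r)) = 0 := by
    ext p q r
    rw [diff₂₃_pow_apply, diff_pow_map, hbc]
    simp
  have h₂ : (diff₁₃ ^ N) (fun p q r => commutator a c (b.1 q v) p r) = 0 := by
    ext p q r
    rw [diff₁₃_pow_apply]
    exact congrFun (congrFun (hac (b.1 q v)) p) r
  rw [e, map_add, h₁, zero_add, ← Module.End.mul_apply,
    (commute_diff₁₃_diff₂₃.pow_pow _ _).eq, Module.End.mul_apply, h₂, map_zero]

theorem diff_pow_commutator_comp' {a b c : FieldOn V} {N : ℕ}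
    (hac : ∀ v, (diff ^ N) (commutator a c v) = 0) (hbc : ∀ v, (diff ^ N) (commutator b c v) = 0)
    (v : V) : (diff₁₃ ^ N) ((diff₂₃ ^ N)
      fun p q r => b.1 q (a.1 p (c.1 r v)) - c.1 r (b.1 q (a.1 p v))) = 0 := by
  have e : (fun p q r => b.1 q (a.1 p (c.1 r v)) - c.1 r (b.1 q (a.1 p v))) =
      (fun p q r => commutator b c (a.1 p v) q r) +
        fun p q r => b.1 q (commutator a c v p r) := by
    ext p q r; simp [commutator]
  have h₁ : (diff₂₃ ^ N) (fun p q r => commutator b c (a.1 p v) q r) = 0 := by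
    ext p q r
    rw [diff₂₃_pow_apply]
    exact congrFun (congrFun (hbc (a.1 p v)) q) r
  have h₂ : (diff₁₃ ^ N) (fun p q r => b.1 q (commutator a c v p r)) = 0 := by
    ext p q r
    rw [diff₁₃_pow_apply, diff_pow_map, hac]
    simp
  rw [e, map_add, h₁, zero_add, ← Module.End.mul_apply,
    (commute_diff₁₃_diff₂₃.pow_pow _ _).eq, Module.End.mul_apply, h₂, map_zero]

theorem diff_pow_kernelCommutator (n : ℤ) {a b c : FieldOn V} {N : ℕ}
    (hac : ∀ v, (diff ^ N) (commutator a c v) = 0) (hbc : ∀ v, (diff ^ N) (commutator b c v) = 0)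
    (v : V) : (diff₁₃ ^ N) ((diff₂₃ ^ N) (kernelCommutator n a b c v)) = 0 := by
  set E : ℤ → ℤ → ℤ → V := fun p q r => a.1 p (b.1 q (c.1 r v)) - c.1 r (a.1 p (b.1 q v))
    with hE
  set E' : ℤ → ℤ → ℤ → V := fun p q r => b.1 q (a.1 p (c.1 r v)) - c.1 r (b.1 q (a.1 p v))
    with hE'
  have f₁ : ShiftFinite (fun k => n - k) (fun k => k) E := fun p q r => by
    filter_upwards [eventually_mode b q (c.1 r v), eventually_mode b q v] with k h₁ h₂
    simp [hE, h₁, h₂]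
  have f₂ : ShiftFinite (fun k => k) (fun k => n - k) E' := fun p q r => by
    filter_upwards [eventually_mode a p (c.1 r v), eventually_mode a p v] with k h₁ h₂
    simp [hE', h₁, h₂]
  have e : kernelCommutator n a b c v = altSumShift n (fun k => n - k) (fun k => k) E -
      (-1 : ℂ) ^ n • altSumShift n (fun k => k) (fun k => n - k) E' := by
    ext p q r
    simp only [kernelCommutator, kernel, altSumShift, hE, hE', Pi.sub_apply, Pi.smul_apply,
      map_sub, map_smul]
    rw [altSum_sub, altSum_sub, altSum_map n (eventually_comp b _ q v) (c.1 r),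
      altSum_map n (eventually_comp a _ p v) (c.1 r)]
    · simp only [add_sub_assoc, smul_sub]; abel
    · exact eventually_comp a _ p _
    · exact (eventually_comp a _ p v).mono fun k hk => by rw [hk, map_zero]
    · exact eventually_comp b _ q _
    · exact (eventually_comp b _ q v).mono fun k hk => by rw [hk, map_zero]
  have z : ∀ α β : ℕ → ℤ, altSumShift n α β (0 : ℤ → ℤ → ℤ → V) = 0 := fun α β => by
    ext p q r; exact altSum_zero n
  have g₁ := altSumShift_diff₂₃_pow n _ _ N f₁
  have g₂ := altSumShift_diff₂₃_pow n _ _ N f₂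
  rw [e, map_sub, map_smul, map_sub, map_smul, ← g₁.2, ← g₂.2,
    ← (altSumShift_diff₁₃_pow n _ _ N g₁.1).2, ← (altSumShift_diff₁₃_pow n _ _ N g₂.1).2,
    diff_pow_commutator_comp hac hbc, diff_pow_commutator_comp' hac hbc, z, z]
  simp

/-- Dong's lemma: products of mutually local fields are local to every field to which the factors
are local. -/
theorem IsLocal.prod_left {a b c : FieldOn V} (hab : IsLocal a b) (hac : IsLocal a c)
    (hbc : IsLocal b c) (n : ℤ) : IsLocal (prod n a b) c := by
  obtain ⟨N₁, h₁⟩ := hab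
  obtain ⟨N₂, h₂⟩ := hac
  obtain ⟨N₃, h₃⟩ := hbc
  obtain ⟨L, s, hL, hs⟩ : ∃ L s : ℕ, N₁ ≤ L ∧ n + s = L :=
    ⟨max N₁ n.toNat, ((max N₁ n.toNat : ℕ) - n).toNat, le_max_left _ _, by omega⟩
  -- `(z - w)ˢ` turns the exponent `n` into `L`, for which the two expansions agree by locality.
  refine ⟨max N₂ N₃ + s + max N₂ N₃, fun v => ?_⟩
  have k : ∀ (p q : ℤ) (w : V), kernel L a b p q w = 0 := fun p q w =>
    congrFun (congrFun ((kernel_natCast L a b w).trans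
      (diff_pow_eq_zero_of_le hL (h₁ w))) p) q
  have h := diff₂₃_pow_eq_zero (N := max N₂ N₃) (s := s) (G := kernelCommutator n a b c v)
    (by
      rw [diff₁₂_pow_kernelCommutator, hs]
      ext p q r
      simp [kernelCommutator, k])
    (diff_pow_kernelCommutator n
      (fun v => diff_pow_eq_zero_of_le (le_max_left _ _) (h₂ v))
      (fun v => diff_pow_eq_zero_of_le (le_max_right _ _) (h₃ v)) v)
  have h0 := congrFun h 0
  rw [diff₂₃_pow_apply] at h0
  exact h0

end FieldOn

/-! ### Translation covariance and the vacuum -/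

section TaylorExpansion

variable {V : Type*} [AddCommGroup V] [Module ℂ V] (T : Module.End ℂ V)

/-- `T F = (∂_z + ∂_w) F`, in terms of the coefficients of `F`. -/
def IsCovariant (F : ℤ → ℤ → V) : Prop :=
  ∀ p q, T (F p q) = -((p : ℂ) • F (p - 1) q + (q : ℂ) • F p (q - 1))

theorem IsCovariant.diff_pow {T : Module.End ℂ V} {F : ℤ → ℤ → V} (h : IsCovariant T F) (N : ℕ) :
    IsCovariant T ((diff ^ N) F) := by
  induction N with
  | zero => exact h
  | succ N ih =>
    rw [pow_succ', Module.End.mul_apply]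
    intro p q
    simp only [diff_apply, map_sub, ih _ _, add_sub_cancel_right, sub_add_cancel]
    push_cast
    module

/-- Taylor's formula `U(z,w) = e^{zT} U(0,w-z)` for a power series with `T U = (∂_z + ∂_w) U`. -/
theorem taylor_expansion (U : ℕ → ℕ → V)
    (hU : ∀ a b, T (U a b) = ((a : ℂ) + 1) • U (a + 1) b + ((b : ℂ) + 1) • U a (b + 1))
    (a b : ℕ) : U a b = ∑ k ∈ Finset.range (a + 1),
      ((-1 : ℂ) ^ (a - k) * ((b + a - k).choose b : ℂ) / (k.factorial : ℂ)) •
        (T ^ k) (U 0 (b + a - k)) := by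
  induction a generalizing b with
  | zero => simp
  | succ a ih =>
    have ha : (a : ℂ) + 1 ≠ 0 := by exact_mod_cast Nat.succ_ne_zero a
    have h : ((a : ℂ) + 1) • U (a + 1) b = T (U a b) - ((b : ℂ) + 1) • U a (b + 1) := by
      rw [hU]; abel
    refine smul_right_injective V ha ?_
    simp only
    set e : ℕ → ℂ := fun k => (-1 : ℂ) ^ (a + 1 - k) * ((b + (a + 1) - k).choose b : ℂ) /
      (k.factorial : ℂ) with he
    set W : ℕ → V := fun k => (T ^ k) (U 0 (b + (a + 1) - k)) with hW
    have s₁ : T (U a b) = ∑ k ∈ Finset.range (a + 1 + 1), ((k : ℂ) * e k) • W k := by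
      rw [Finset.sum_range_succ', ih b, map_sum]
      simp only [Nat.cast_zero, zero_mul, zero_smul, add_zero]
      refine Finset.sum_congr rfl fun k hk => ?_
      have hk' : (k : ℂ) + 1 ≠ 0 := by exact_mod_cast Nat.succ_ne_zero k
      simp only [hW, he, pow_succ' T, Module.End.mul_apply, map_smul, Nat.factorial_succ]
      rw [show b + (a + 1) - (k + 1) = b + a - k by omega, show a + 1 - (k + 1) = a - k by omega]
      congr 1
      push_cast
      field_simp
    have s₂ : ((b : ℂ) + 1) • U a (b + 1) =
        ∑ k ∈ Finset.range (a + 1 + 1), (((k : ℂ) - (a + 1)) * e k) • W k := by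
      rw [Finset.sum_range_succ, ih (b + 1), Finset.smul_sum]
      simp only [Nat.cast_add, Nat.cast_one, sub_self, zero_mul, zero_smul, add_zero]
      refine Finset.sum_congr rfl fun k hk => ?_
      obtain ⟨i, rfl⟩ : ∃ i, a = k + i := ⟨a - k, by have := Finset.mem_range.1 hk; omega⟩
      simp only [hW, he, smul_smul]
      rw [show b + (k + i + 1) - k = b + i + 1 by omega, show k + i + 1 - k = i + 1 by omega,
        show b + 1 + (k + i) - k = b + i + 1 by omega, show k + i - k = i by omega]
      congr 1
      have hc := Nat.choose_succ_right_eq (b + i + 1) b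
      rw [show b + i + 1 - b = i + 1 by omega] at hc
      have hc' : ((b + i + 1).choose (b + 1) : ℂ) * (b + 1) = (b + i + 1).choose b * (i + 1) := by
        exact_mod_cast hc
      push_cast
      linear_combination ((-1 : ℂ) ^ i / k.factorial) * hc'
    rw [h, s₁, s₂, ← Finset.sum_sub_distrib, Finset.smul_sum]
    refine Finset.sum_congr rfl fun k _ => ?_
    rw [← sub_smul, smul_smul]
    congr 1
    ring

end TaylorExpansion

namespace FieldOn

variable {V : Type*} [AddCommGroup V] [Module ℂ V]

/-- Compatibility of a field with a translation operator `T` and a vacuum vector: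
`[T, a(z)] = ∂a(z)`, and `a(z) vac` has no pole. -/
structure IsVertexField (T : Module.End ℂ V) (vac : V) (a : FieldOn V) : Prop where
  translation : ∀ n v, T (a.1 n v) = a.1 n (T v) - (n : ℂ) • a.1 (n - 1) v
  creation : ∀ n, 0 ≤ n → a.1 n vac = 0

variable {T : Module.End ℂ V} {vac : V}

theorem IsVertexField.add {a b : FieldOn V} (ha : IsVertexField T vac a)
    (hb : IsVertexField T vac b) : IsVertexField T vac (a + b) where
  translation n v := by
    simp only [Submodule.coe_add, Pi.add_apply, LinearMap.add_apply, map_add, ha.translation,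
      hb.translation, smul_add]
    abel
  creation n hn := by simp [ha.creation n hn, hb.creation n hn]

theorem IsVertexField.smul {a : FieldOn V} (c : ℂ) (ha : IsVertexField T vac a) :
    IsVertexField T vac (c • a) where
  translation n v := by
    simp only [Submodule.coe_smul, Pi.smul_apply, LinearMap.smul_apply, map_smul, ha.translation,
      smul_sub, smul_comm c]
  creation n hn := by simp [ha.creation n hn]

/-- The cancellation which makes the derivative a derivation of the products of fields. -/
theorem altSum_sub_telescope (m n : ℤ) {f g u : ℕ → V} (hf : ∀ᶠ k in atTop, f k = 0)
    (hu : ∀ᶠ k in atTop, u k = 0) (hg : ∀ᶠ k in atTop, g k = 0) :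
    altSum m (fun k => f k - ((n : ℂ) • u k + ((k : ℂ) • g k + ((m : ℂ) - k) • g (k + 1)))) =
      altSum m f - (n : ℂ) • altSum m u := by
  have hg₀ : ∀ᶠ k : ℕ in atTop, (k : ℂ) • g k = 0 := hg.mono fun k hk => by simp [hk]
  have hg₁ : ∀ᶠ k : ℕ in atTop, ((m : ℂ) - k) • g (k + 1) = 0 :=
    ((tendsto_add_atTop_nat 1).eventually hg).mono fun k hk => by simp [hk]
  have hu₁ : ∀ᶠ k : ℕ in atTop, (n : ℂ) • u k = 0 := hu.mono fun k hk => by simp [hk]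
  have hs : ∀ᶠ k : ℕ in atTop, (k : ℂ) • g k + ((m : ℂ) - k) • g (k + 1) = 0 := by
    filter_upwards [hg₀, hg₁] with k h₀ h₁
    rw [h₀, h₁, add_zero]
  rw [altSum_sub m hf (by filter_upwards [hu₁, hs] with k h₀ h₁; rw [h₀, h₁, add_zero]),
    altSum_add m hu₁ hs, altSum_add m hg₀ hg₁, altSum_nat_smul m hg, altSum_smul m _ hu,
    neg_add_cancel, add_zero]

theorem IsVertexField.prod {a b : FieldOn V} (ha : IsVertexField T vac a)
    (hb : IsVertexField T vac b) (m : ℤ) : IsVertexField T vac (prod m a b) where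
  translation n v := by
    set g : ℕ → V := fun k => a.1 (m - k) (b.1 (n - 1 + k) v) with hg
    set h : ℕ → V := fun k => b.1 (n + m - k) (a.1 (-1 + k) v) with hh
    have g0 : ∀ᶠ k in atTop, g k = 0 := eventually_comp b _ _ _
    have h0 : ∀ᶠ k in atTop, h k = 0 := eventually_comp a _ _ _
    have g1 : ∀ᶠ k in atTop, g (k + 1) = 0 := (tendsto_add_atTop_nat 1).eventually g0
    have h1 : ∀ᶠ k in atTop, h (k + 1) = 0 := (tendsto_add_atTop_nat 1).eventually h0
    have eA : ∀ k : ℕ, T (a.1 (0 + m - k) (b.1 (n + k) v)) = a.1 (0 + m - k) (b.1 (n + k) (T v))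
        - ((n : ℂ) • g k + ((k : ℂ) • g k + ((m : ℂ) - k) • g (k + 1))) := fun k => by
      have e₁ : n + (k : ℤ) - 1 = n - 1 + k := by ring
      have e₂ : m - (k : ℤ) - 1 = m - ((k + 1 : ℕ) : ℤ) := by push_cast; ring
      have e₃ : n + (k : ℤ) = n - 1 + ((k + 1 : ℕ) : ℤ) := by push_cast; ring
      rw [ha.translation, hb.translation]
      simp only [hg, ← e₁, ← e₂, ← e₃, map_sub, map_smul, zero_add]
      push_cast
      module
    have eB : ∀ k : ℕ, T (b.1 (n + m - k) (a.1 (0 + k) v)) = b.1 (n + m - k) (a.1 (0 + k) (T v))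
        - ((n : ℂ) • h (k + 1) + ((k : ℂ) • h k + ((m : ℂ) - k) • h (k + 1))) := fun k => by
      have e₁ : (k : ℤ) - 1 = - 1 + k := by ring
      have e₂ : n + m - (k : ℤ) - 1 = n + m - ((k + 1 : ℕ) : ℤ) := by push_cast; ring
      have e₃ : (k : ℤ) = - 1 + ((k + 1 : ℕ) : ℤ) := by push_cast; ring
      rw [hb.translation, ha.translation]
      simp only [hh, ← e₁, ← e₂, ← e₃, map_sub, map_smul, zero_add]
      push_cast
      module
    simp only [prod_apply]
    rw [kernel, map_sub, map_smul, ← altSum_map m (eventually_comp b _ _ _) T,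
      ← altSum_map m (eventually_comp a _ _ _) T]
    simp only [eA, eB]
    rw [altSum_sub_telescope m n (eventually_comp b _ _ _) g0 g0,
      altSum_sub_telescope m n (eventually_comp a _ _ _) h1 h0, kernel, kernel]
    have e : ∀ k : ℕ, h (k + 1) = b.1 (n - 1 + m - k) (a.1 (0 + k) v) := fun k => by
      have e₂ : n - 1 + m - (k : ℤ) = n + m - ((k + 1 : ℕ) : ℤ) := by push_cast; ring
      have e₃ : 0 + (k : ℤ) = - 1 + ((k + 1 : ℕ) : ℤ) := by push_cast; ring
      rw [e₂, e₃]
    simp only [e, hg, zero_add]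
    module
  creation n hn := by
    have h₁ : ∀ k : ℕ, b.1 (n + k) vac = 0 := fun k => hb.creation _ (by omega)
    have h₂ : ∀ k : ℕ, a.1 k vac = 0 := fun k => ha.creation _ (by omega)
    simp [prod_apply, kernel, h₁, h₂, altSum_zero]

/-- The state `a₋₁ vac` of a field. -/
def state (vac : V) : FieldOn V →ₗ[ℂ] V where
  toFun a := a.1 (-1) vac
  map_add' _ _ := rfl
  map_smul' _ _ := rfl

theorem altSum_single (n : ℤ) {f : ℕ → V} (j : ℕ) (h : ∀ k, k ≠ j → f k = 0) :
    altSum n f = altChoose n j • f j :=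
  finsum_eq_single _ j fun k hk => by rw [h k hk, smul_zero]

/-- On states, the `m`-th product with `a` is the action of the mode `aₘ`. -/
theorem state_prod {a b : FieldOn V} (ha : IsVertexField T vac a) (hb : IsVertexField T vac b)
    (m : ℤ) : state vac (prod m a b) = a.1 m (state vac b) := by
  have h₂ : ∀ k : ℕ, a.1 k vac = 0 := fun k => ha.creation _ (by omega)
  change kernel m a b 0 (-1) vac = a.1 m (b.1 (-1) vac)
  rw [kernel, altSum_single m (f := fun k : ℕ => a.1 (0 + m - k) (b.1 (-1 + k) vac)) 0
    fun k hk => by rw [hb.creation _ (by omega), map_zero]]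
  simp [h₂, altSum_zero, altChoose_zero]

/-- If the state of `a` vanishes then so does `a(z) vac`, and by locality `a(z)` annihilates the
states of all fields to which it is local. -/
theorem IsVertexField.apply_state_eq_zero {a b : FieldOn V} (hT : T vac = 0)
    (ha : IsVertexField T vac a) (hb : IsVertexField T vac b) (hab : IsLocal a b)
    (h : state vac a = 0) (n : ℤ) : a.1 n (state vac b) = 0 := by
  have h0 : ∀ n, a.1 n vac = 0 := fun n => by
    rcases le_or_gt 0 n with hn | hn
    · exact ha.creation n hn
    · obtain ⟨j, rfl⟩ : ∃ j : ℕ, n = -1 - j := ⟨(-1 - n).toNat, by omega⟩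
      clear hn
      induction j with
      | zero => simpa [state] using h
      | succ j ih =>
        have ht := ha.translation (-1 - j) vac
        rw [ih, hT, map_zero, map_zero, zero_sub, eq_comm, neg_eq_zero, smul_eq_zero] at ht
        rcases ht with ht | ht
        · exfalso
          have : (-1 - (j : ℤ)) = 0 := by exact_mod_cast ht
          omega
        · rw [← ht, show -1 - ((j + 1 : ℕ) : ℤ) = -1 - (j : ℤ) - 1 by push_cast; ring]
  obtain ⟨N, hN⟩ := hab
  have e : commutator a b vac = fun p q => a.1 p (b.1 q vac) := by
    ext p q; simp [commutator, h0]
  have hr := (diff_pow_right N (F := fun p q => a.1 p (b.1 q vac))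
    (fun p q hq => by simp [hb.creation q hq]) (n - N)).2
  rw [← e, hN] at hr
  simpa [state] using hr.symm

theorem isCovariant_comp {a b : FieldOn V} (hT : T vac = 0) (ha : IsVertexField T vac a)
    (hb : IsVertexField T vac b) : IsCovariant T fun p q => a.1 p (b.1 q vac) := fun p q => by
  simp only [ha.translation, hb.translation, hT, map_zero, map_sub, map_smul]
  module

/-- Skew-symmetry `a(z) b = e^{zT} b(-z) a` on states. -/
theorem IsVertexField.skew_symmetry {a b : FieldOn V} (hT : T vac = 0)
    (ha : IsVertexField T vac a) (hb : IsVertexField T vac b) (hab : IsLocal a b) (n : ℤ) :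
    ∃ K : ℕ, (∀ k : ℕ, K ≤ k → b.1 (n + k) (state vac a) = 0) ∧
      a.1 n (state vac b) + ∑ k ∈ Finset.range K, ((-1 : ℂ) ^ (n + k) / (k.factorial : ℂ)) •
        (T ^ k) (b.1 (n + k) (state vac a)) = 0 := by
  obtain ⟨N, hN⟩ := hab
  set F : ℤ → ℤ → V := fun p q => a.1 p (b.1 q vac) with hF
  set F' : ℤ → ℤ → V := fun p q => b.1 q (a.1 p vac) with hF'
  have hFF' : (diff ^ N) F = (diff ^ N) F' := by
    have e : commutator a b vac = F - F' := rfl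
    have h := hN vac
    rwa [e, map_sub, sub_eq_zero] at h
  have hr := fun p => diff_pow_right N (F := F) (fun p q hq => by simp [hF, hb.creation q hq]) p
  have hl := fun q => diff_pow_left N (F := F') (fun p q hp => by simp [hF', ha.creation p hp]) q
  rw [← hFF'] at hl
  -- `(z - w)ᴺ a(z) b(w) vac` has no negative powers of `w`, and equals `(z - w)ᴺ b(w) a(z) vac`,
  -- which has none of `z`.
  have hcov : IsCovariant T ((diff ^ N) F) := (isCovariant_comp hT ha hb).diff_pow N
  have hvan : ∀ q, 0 ≤ q → b.1 (q + N) (state vac a) = 0 := fun q hq => by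
    have h := (hl q).2
    rw [(hr (-1)).1 q hq, eq_comm, smul_eq_zero] at h
    exact h.resolve_left (pow_ne_zero _ (by norm_num))
  refine ⟨(N - n).toNat, fun k hk => ?_, ?_⟩
  · have := hvan (n + k - N) (by omega)
    rwa [sub_add_cancel] at this
  rcases le_or_gt (N : ℤ) n with hn | hn
  · rw [show (N - n).toNat = 0 by omega, Finset.sum_range_zero, add_zero]
    have h := (hr (n - N)).2
    rw [(hl (-1)).1 _ (by omega), sub_add_cancel] at h
    exact h.symm
  · obtain ⟨j, rfl⟩ : ∃ j : ℕ, n = N - 1 - j := ⟨(N - 1 - n).toNat, by omega⟩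
    have hU := taylor_expansion T (fun a b => (diff ^ N) F (-1 - a) (-1 - b)) (fun a b => by
      rw [hcov]
      have e₁ : (-1 - (a : ℤ) - 1) = -1 - ((a + 1 : ℕ) : ℤ) := by push_cast; ring
      have e₂ : (-1 - (b : ℤ) - 1) = -1 - ((b + 1 : ℕ) : ℤ) := by push_cast; ring
      rw [e₁, e₂]
      push_cast
      module) j 0
    rw [show ((N : ℤ) - (N - 1 - j)).toNat = j + 1 by omega]
    have e₀ : a.1 (N - 1 - j) (state vac b) = (diff ^ N) F (-1 - j) (-1 - (0 : ℕ)) := by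
      rw [Nat.cast_zero, sub_zero, (hr _).2, show -1 - (j : ℤ) + N = N - 1 - j by ring]
      rfl
    rw [e₀, hU, ← Finset.sum_add_distrib]
    refine Finset.sum_eq_zero fun k hk => ?_
    obtain ⟨i, rfl⟩ : ∃ i, j = k + i := ⟨j - k, by have := Finset.mem_range.1 hk; omega⟩
    have e₁ : ((N : ℤ) - 1 - ((k + i : ℕ) : ℤ) + k) = N - 1 - i := by push_cast; ring
    have e₂ : (-1 : ℂ) ^ ((N : ℤ) - 1 - i) = -((-1) ^ N * (-1) ^ i) := by
      rw [zpow_sub₀ (by norm_num), zpow_sub₀ (by norm_num), zpow_natCast, zpow_natCast, zpow_one,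
        div_eq_mul_inv, ← inv_pow, inv_neg_one]
      ring
    have e₃ : b.1 (N - 1 - i) (state vac a) = (-1 : ℂ) ^ N • (diff ^ N) F (-1) (-1 - i) := by
      rw [(hl _).2, smul_smul, ← mul_pow, neg_mul_neg, mul_one, one_pow, one_smul,
        show -1 - (i : ℤ) + N = N - 1 - i by ring]
      rfl
    rw [e₁, e₂, e₃]
    simp only [zero_add, Nat.choose_zero_right, Nat.cast_zero, sub_zero, Nat.add_sub_cancel_left,
      Nat.cast_one, mul_one, map_smul, smul_smul, ← add_smul]
    convert zero_smul ℂ _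
    have : (-1 : ℂ) ^ N * (-1) ^ N = 1 := by rw [← mul_pow]; simp
    linear_combination (-(-1 : ℂ) ^ i / k.factorial) * this

end FieldOn

/-! ### Relations satisfied by local fields generating a vacuum module -/

namespace FieldOn

variable {V : Type*} [AddCommGroup V] [Module ℂ V]
variable {v : Type*} [AddCommGroup v] [Module ℂ v]

/-- A linear family `f` of pairwise local fields on `V`, translation covariant with respect to `T`,
with `f e` the identity field, whose modes generate `V` from the vacuum vector. -/
structure IsGenerating (T : Module.End ℂ V) (vac : V) (e : v) (f : v →ₗ[ℂ] FieldOn V) : Prop where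
  translation_vac : T vac = 0
  one_apply : ∀ n x, (f e).1 n x = if n = -1 then x else 0
  isVertexField : ∀ u, IsVertexField T vac (f u)
  isLocal : ∀ u w, IsLocal (f u) (f w)
  cyclic : ∀ S : Submodule ℂ V, vac ∈ S → (∀ u n, ∀ x ∈ S, (f u).1 n x ∈ S) → S = ⊤

/-- The field `a₋₂𝟏` is the derivative of `a`. -/
theorem prod_neg_two_one {a b : FieldOn V} (hb : ∀ n x, b.1 n x = if n = -1 then x else 0)
    (n : ℤ) (x : V) : (prod (-2) a b).1 n x = -((n : ℂ) • a.1 (n - 1) x) := by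
  rw [prod_apply, kernel]
  simp only [hb, zero_add]
  have z₁ : 0 ≤ n → altSum (-2) (fun k : ℕ => a.1 (-2 - k) (if n + k = -1 then x else 0)) = 0 :=
    fun hn => by
      rw [altSum_single (-2) 0 fun k _ => by rw [if_neg (by omega), map_zero],
        if_neg (by omega), map_zero, smul_zero]
  have z₂ : n ≤ 0 → altSum (-2) (fun k : ℕ => if n + -2 - k = -1 then a.1 k x else 0) = 0 :=
    fun hn => by
      rw [altSum_single (-2) 0 fun k _ => by rw [if_neg (by omega)],
        if_neg (by omega), smul_zero]
  rcases lt_trichotomy n 0 with hn | rfl | hn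
  · obtain ⟨j, rfl⟩ : ∃ j : ℕ, n = -1 - j := ⟨(-1 - n).toNat, by omega⟩
    rw [z₂ hn.le, altSum_single (-2) j fun k hk => by rw [if_neg (by omega), map_zero],
      if_pos (by omega), altChoose_neg_two, show (-1 - (j : ℤ) - 1) = -2 - j by ring]
    push_cast
    module
  · rw [z₁ le_rfl, z₂ le_rfl]; simp
  · obtain ⟨j, rfl⟩ : ∃ j : ℕ, n = 1 + j := ⟨(n - 1).toNat, by omega⟩
    rw [z₁ hn.le, altSum_single (-2) j fun k hk => by rw [if_neg (by omega)],
      if_pos (by omega), altChoose_neg_two, show (1 + (j : ℤ) - 1) = j by ring]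
    have h : (-1 : ℂ) ^ (-2 : ℤ) = 1 := by norm_num
    rw [h]
    push_cast
    module

namespace IsGenerating

variable {T : Module.End ℂ V} {vac : V} {e : v} {f : v →ₗ[ℂ] FieldOn V}

theorem isVertexField_lift (h : IsGenerating T vac e f) (x : IFA v) :
    IsVertexField T vac (IFA.lift prod f x) := by
  rcases x with ⟨x⟩
  change IsVertexField T vac (IFA.preLift prod f x)
  induction x with
  | of u => exact h.isVertexField u
  | add a b iha ihb => exact iha.add ihb
  | smul c a iha => exact iha.smul c
  | mul n a b iha ihb => exact iha.prod ihb n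

/-- The number of constructors in a formal expression. -/
def exprSize {v : Type*} : PreIFA v → ℕ
  | .of _ => 1
  | .add a b => exprSize a + exprSize b + 1
  | .smul _ a => exprSize a + 1
  | .mul _ a b => exprSize a + exprSize b + 1

theorem isLocal_preLift (h : IsGenerating T vac e f) (x y : PreIFA v) :
    IsLocal (IFA.preLift prod f x) (IFA.preLift prod f y) := by
  induction hs : exprSize x + exprSize y using Nat.strong_induction_on generalizing x y with
  | _ s ih =>
    subst hs
    -- Dong's lemma for a product `a ∘ₙ b` needs locality of the pairs `(a, b)`, `(a, y)` and
    -- `(b, y)`, all of smaller total size.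
    have main : ∀ x' y', exprSize x' + exprSize y' = exprSize x + exprSize y →
        (∀ u, x' ≠ .of u) → IsLocal (IFA.preLift prod f x') (IFA.preLift prod f y') := by
      intro x' y' hs hx'
      cases x' with
      | of u => exact absurd rfl (hx' u)
      | add a b =>
        simp only [exprSize] at hs
        exact (ih _ (by omega) a y' rfl).add_left (ih _ (by omega) b y' rfl)
      | smul c a =>
        simp only [exprSize] at hs
        exact (ih _ (by omega) a y' rfl).smul_left c
      | mul n a b =>
        have hy : 0 < exprSize y' := by cases y' <;> simp [exprSize]
        simp only [exprSize] at hs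
        exact (ih _ (by omega) a b rfl).prod_left (ih _ (by omega) a y' rfl)
          (ih _ (by omega) b y' rfl) n
    by_cases hx : ∃ u, x = .of u
    · by_cases hy : ∃ w, y = .of w
      · obtain ⟨u, rfl⟩ := hx
        obtain ⟨w, rfl⟩ := hy
        exact h.isLocal u w
      · exact (main y x (add_comm _ _) fun u hu => hy ⟨u, hu⟩).symm
    · exact main x y rfl fun u hu => hx ⟨u, hu⟩

theorem isLocal_lift (h : IsGenerating T vac e f) (x y : IFA v) :
    IsLocal (IFA.lift prod f x) (IFA.lift prod f y) := by
  rcases x with ⟨x⟩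
  rcases y with ⟨y⟩
  exact h.isLocal_preLift x y

theorem state_lift_mul (h : IsGenerating T vac e f) (n : ℤ) (x y : IFA v) :
    state vac (IFA.lift prod f (IFA.mul n x y)) =
      (IFA.lift prod f x).1 n (state vac (IFA.lift prod f y)) := by
  rw [IFA.lift_mul, state_prod (h.isVertexField_lift x) (h.isVertexField_lift y)]

theorem state_one (h : IsGenerating T vac e f) : state vac (f e) = vac := by
  simp [state, h.one_apply]

theorem exists_state (h : IsGenerating T vac e f) (w : V) :
    ∃ x : IFA v, state vac (IFA.lift prod f x) = w := by
  have hS := h.cyclic (LinearMap.range (state vac ∘ₗ IFA.lift prod f))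
    ⟨IFA.ι e, h.state_one⟩ (by
      rintro u n _ ⟨x, rfl⟩
      exact ⟨IFA.mul n (IFA.ι u) x, by simp [h.state_lift_mul, IFA.lift_ι]⟩)
  have hw : w ∈ LinearMap.range (state vac ∘ₗ IFA.lift prod f) := hS ▸ Submodule.mem_top
  exact hw

/-- Goddard's uniqueness: the fields generated by `f` are determined by their states. -/
theorem mem_ker_iff (h : IsGenerating T vac e f) (x : IFA v) :
    x ∈ LinearMap.ker (IFA.lift prod f) ↔ state vac (IFA.lift prod f x) = 0 := by
  rw [LinearMap.mem_ker]
  refine ⟨fun hx => by rw [hx, map_zero], fun hx => ?_⟩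
  ext n w
  obtain ⟨y, rfl⟩ := h.exists_state w
  exact (h.isVertexField_lift x).apply_state_eq_zero h.translation_vac (h.isVertexField_lift y)
    (h.isLocal_lift x y) hx n

theorem lift_D_apply (h : IsGenerating T vac e f) (x : IFA v) (n : ℤ) (w : V) :
    (IFA.lift prod f (IFA.D e x)).1 n w = -((n : ℂ) • (IFA.lift prod f x).1 (n - 1) w) := by
  have hD : IFA.D e x = IFA.mul (-2) x (IFA.ι e) := rfl
  rw [hD, IFA.lift_mul, IFA.lift_ι, prod_neg_two_one h.one_apply]

theorem state_D (h : IsGenerating T vac e f) (x : IFA v) :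
    state vac (IFA.lift prod f (IFA.D e x)) = T (state vac (IFA.lift prod f x)) := by
  change (IFA.lift prod f (IFA.D e x)).1 (-1) vac = T ((IFA.lift prod f x).1 (-1) vac)
  rw [h.lift_D_apply, (h.isVertexField_lift x).translation, h.translation_vac]
  simp

theorem state_D_pow (h : IsGenerating T vac e f) (k : ℕ) (x : IFA v) :
    state vac (IFA.lift prod f ((IFA.D e ^ k) x)) =
      (T ^ k) (state vac (IFA.lift prod f x)) := by
  induction k with
  | zero => rfl
  | succ k ih =>
    rw [pow_succ', pow_succ', Module.End.mul_apply, Module.End.mul_apply, h.state_D, ih]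

/-- The kernel of the evaluation of formal expressions on fields satisfies the vertex algebra
relations. By Goddard's uniqueness they need only be checked on states, where
quasi-associativity becomes the definition of the products of fields. -/
theorem containsVertexRelations (h : IsGenerating T vac e f) (N : v → v → ℕ)
    (hN : ∀ u w (n : ℤ), (N u w : ℤ) ≤ n → (f u).1 n (state vac (f w)) = 0) (M : ℕ) :
    IFA.ContainsVertexRelations e N M (LinearMap.ker (IFA.lift prod f)) where
  isIdeal n x y hy := by
    rw [LinearMap.mem_ker] at hy
    constructor <;> rw [LinearMap.mem_ker, IFA.lift_mul, hy] <;> simp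
  identity x n _ := by
    rw [h.mem_ker_iff, map_sub, map_sub, h.state_lift_mul, IFA.lift_ι, h.one_apply]
    by_cases hn : n = -1
    · simp [hn]
    · rw [if_neg hn, if_neg (by omega)]; simp
  locality u w n hn := by
    rw [h.mem_ker_iff, h.state_lift_mul]
    exact hN u w n hn
  derivation x y n _ := by
    rw [h.mem_ker_iff]
    simp only [map_sub, h.state_lift_mul, h.state_D, h.lift_D_apply,
      (h.isVertexField_lift x).translation]
    module
  translation x y n := by
    rw [h.mem_ker_iff]
    simp only [map_add, map_smul, h.state_lift_mul, h.lift_D_apply]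
    module
  quasiComm x y n _ K hK := by
    obtain ⟨L, hL, hsum⟩ := (h.isVertexField_lift x).skew_symmetry h.translation_vac
      (h.isVertexField_lift y) (h.isLocal_lift x y) n
    set t : ℕ → V := fun k => ((-1 : ℂ) ^ (n + k) / (k.factorial : ℂ)) •
      (T ^ k) ((IFA.lift prod f y).1 (n + k) (state vac (IFA.lift prod f x))) with ht
    have hst : ∀ k : ℕ, state vac (IFA.lift prod f (((-1 : ℂ) ^ (n + k) / (k.factorial : ℂ)) •
        (IFA.D e ^ k) (IFA.mul (n + k) y x))) = t k := fun k => by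
      simp only [map_smul, h.state_D_pow, h.state_lift_mul, ht]
    have hKt : ∀ k, K ≤ k → t k = 0 := fun k hk => by
      rw [← hst, ← h.mem_ker_iff]; exact hK k hk
    have hLt : ∀ k, L ≤ k → t k = 0 := fun k hk => by
      simp only [ht, hL k hk, map_zero, smul_zero]
    have hKL : ∑ k ∈ Finset.range K, t k = ∑ k ∈ Finset.range L, t k := by
      rw [Finset.sum_subset (Finset.range_subset_range.2 (le_max_left K L))
        fun k _ hk => hKt k (by simpa using hk),
        Finset.sum_subset (Finset.range_subset_range.2 (le_max_right K L))
        fun k _ hk => hLt k (by simpa using hk)]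
    rw [h.mem_ker_iff]
    simp only [map_add, map_sum, hst, h.state_lift_mul]
    rw [hKL]
    exact hsum
  quasiAssoc x y z m n _ _ K hK := by
    set a := IFA.lift prod f x with ha
    set b := IFA.lift prod f y with hb
    set w := state vac (IFA.lift prod f z) with hw
    set t : ℕ → V := fun k => altChoose m k •
      (a.1 (m - k) (b.1 (n + k) w) - (-1 : ℂ) ^ m • b.1 (m + n - k) (a.1 k w)) with ht
    have hst : ∀ k : ℕ, state vac (IFA.lift prod f
        (-(((Ring.choose m k : ℤ) : ℂ) * (-1 : ℂ) ^ k) •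
          (IFA.mul (m - k) x (IFA.mul (n + k) y z)
            - (-1 : ℂ) ^ m • IFA.mul (m + n - k) y (IFA.mul k x z)))) = -t k := fun k => by
      simp only [map_smul, map_sub, h.state_lift_mul, ht, altChoose, neg_smul, map_neg, ha, hb, hw]
    have hKt : ∀ k, K ≤ k → t k = 0 := fun k hk => by
      rw [← neg_eq_zero, ← hst, ← h.mem_ker_iff]; exact hK k hk
    have hz : ∀ᶠ k : ℕ in atTop, (-1 : ℂ) ^ m • b.1 (n + m - k) (a.1 (0 + k) w) = 0 :=
      (eventually_comp a _ 0 w).mono fun k hk => by rw [hk, smul_zero]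
    have hk : kernel m a b 0 n w = ∑ k ∈ Finset.range K, t k := by
      rw [kernel, ← altSum_smul m _ (eventually_comp a _ 0 w),
        ← altSum_sub m (eventually_comp b _ n w) hz, altSum]
      simp only [zero_add, add_comm n m]
      refine finsum_eq_finsetSum_of_support_subset t fun k hk => ?_
      by_contra hk'
      simp only [Finset.coe_range, Set.mem_Iio, not_lt] at hk'
      exact hk (hKt k hk')
    rw [h.mem_ker_iff]
    simp only [map_add, map_sum, hst]
    rw [h.state_lift_mul, IFA.lift_mul, prod_apply, Finset.sum_neg_distrib]
    exact add_neg_eq_zero.2 hk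

end IsGenerating

end FieldOn

/-! ### Modules induced from a complementary subalgebra -/

namespace InducedModule

attribute [local instance] LieRing.ofAssociativeRing

open UniversalEnvelopingAlgebra

variable {L : Type*} [LieRing L] [LieAlgebra ℂ L] {A : LieSubalgebra ℂ L}

/-- The induction principle for `U(A)`: it is spanned by the products of elements of `A`. -/
theorem eq_top_of_ι_mul_mem {A : Type*} [LieRing A] [LieAlgebra ℂ A]
    (S : Submodule ℂ (UniversalEnvelopingAlgebra ℂ A)) (h1 : 1 ∈ S)
    (hS : ∀ (y : A), ∀ u ∈ S, ι ℂ y * u ∈ S) : S = ⊤ := by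
  let B : Subalgebra ℂ (UniversalEnvelopingAlgebra ℂ A) :=
    { carrier := {a | ∀ u ∈ S, a * u ∈ S}
      mul_mem' := fun {a b} ha hb u hu => by rw [mul_assoc]; exact ha _ (hb u hu)
      add_mem' := fun {a b} ha hb u hu => by rw [add_mul]; exact S.add_mem (ha u hu) (hb u hu)
      algebraMap_mem' := fun c u hu => by
        rw [← Algebra.smul_def]; exact S.smul_mem c hu }
  let g : A →ₗ⁅ℂ⁆ B :=
    { toFun := fun y => ⟨ι ℂ y, hS y⟩
      map_add' := fun x y => Subtype.ext (map_add _ _ _)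
      map_smul' := fun c x => Subtype.ext (map_smul _ _ _)
      map_lie' := fun {x y} => Subtype.ext (LieHom.map_lie _ _ _) }
  have hB : B.val.comp (lift ℂ g) = AlgHom.id ℂ _ := by
    ext y
    simp only [LieHom.coe_comp, Function.comp_apply, AlgHom.coe_toLieHom, AlgHom.comp_apply,
      lift_ι_apply]
    rfl
  refine eq_top_iff.2 fun a _ => ?_
  have ha : a ∈ B := by
    have h := congrArg (fun φ : _ →ₐ[ℂ] _ => φ a) hB
    simp only [AlgHom.comp_apply, AlgHom.id_apply] at h
    rw [← h]
    exact (lift ℂ g a).2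
  simpa using ha 1 h1

variable (p : L →ₗ[ℂ] A)

variable (A) in
/-- The representation of a subalgebra `A` of `L` on `Hom(L, U(A))` combining left multiplication
on `U(A)` and the adjoint action on `L`: `(y R)(x) = y R(x) + R([x, y])`. -/
noncomputable def homRep : A →ₗ⁅ℂ⁆ Module.End ℂ (L →ₗ[ℂ] UniversalEnvelopingAlgebra ℂ A) where
  toFun y :=
    { toFun := fun R =>
        { toFun := fun x => ι ℂ y * R x + R ⁅x, (y : L)⁆
          map_add' := fun x x' => by simp only [map_add, mul_add, add_lie]; abel
          map_smul' := fun c x => by simp }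
      map_add' := fun R R' => by ext x; simp [mul_add]; abel
      map_smul' := fun c R => by ext x; simp }
  map_add' y y' := by ext R x; simp [add_mul]; abel
  map_smul' c y := by ext R x; simp
  map_lie' {y y'} := by
    ext R x
    have h : ⁅x, ⁅(y : L), (y' : L)⁆⁆ = ⁅⁅x, (y : L)⁆, (y' : L)⁆ - ⁅⁅x, (y' : L)⁆, (y : L)⁆ := by
      rw [leibniz_lie, ← lie_skew ⁅x, (y' : L)⁆ (y : L), sub_neg_eq_add]
    change ι ℂ ⁅y, y'⁆ * R x + R ⁅x, ⁅(y : L), (y' : L)⁆⁆ =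
      (ι ℂ y * (ι ℂ y' * R x + R ⁅x, (y' : L)⁆) +
        (ι ℂ y' * R ⁅x, (y : L)⁆ + R ⁅⁅x, (y : L)⁆, (y' : L)⁆)) -
      (ι ℂ y' * (ι ℂ y * R x + R ⁅x, (y : L)⁆) +
        (ι ℂ y * R ⁅x, (y' : L)⁆ + R ⁅⁅x, (y' : L)⁆, (y : L)⁆))
    rw [h, LieHom.map_lie, LieRing.of_associative_ring_bracket, map_sub]
    simp only [sub_mul, mul_add, mul_assoc]
    abel

variable (p : L →ₗ[ℂ] A)

/-- The action of `L` on `U(A)` induced by a projection `p` of `L` onto `A`; `act p u x` is the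
result of applying `x` to `u`. It is the orbit map of `ι ∘ p`, regarded as `x ↦ x 1`, in
`Hom(L, U(A))`. -/
noncomputable def act : UniversalEnvelopingAlgebra ℂ A →ₗ[ℂ]
    L →ₗ[ℂ] UniversalEnvelopingAlgebra ℂ A :=
  (LinearMap.applyₗ ((ι ℂ : A →ₗ⁅ℂ⁆ UniversalEnvelopingAlgebra ℂ A).toLinearMap ∘ₗ p)) ∘ₗ
    (lift ℂ (homRep A)).toLinearMap

theorem act_one (x : L) : act p 1 x = ι ℂ (p x) := by
  simp [act]

theorem act_ι_mul (y : A) (u : UniversalEnvelopingAlgebra ℂ A) (x : L) :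
    act p (ι ℂ y * u) x = ι ℂ y * act p u x + act p u ⁅x, (y : L)⁆ := by
  have h : lift ℂ (homRep A) (ι ℂ y * u) = homRep A y * lift ℂ (homRep A) u := by
    rw [map_mul, lift_ι_apply]
  simp only [act, LinearMap.comp_apply, AlgHom.toLinearMap_apply, h]
  rfl

/-- The subalgebra `A` acts by left multiplication. -/
theorem act_coe (hA : ∀ a : A, p a = a) (y : A) (u : UniversalEnvelopingAlgebra ℂ A) :
    act p u (y : L) = ι ℂ y * u := by
  let S : Submodule ℂ (UniversalEnvelopingAlgebra ℂ A) :=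
    { carrier := {u | ∀ y : A, act p u (y : L) = ι ℂ y * u}
      add_mem' := fun {u w} hu hw y => by
        rw [map_add, LinearMap.add_apply, hu y, hw y, mul_add]
      zero_mem' := fun y => by simp
      smul_mem' := fun c u hu y => by
        rw [map_smul, LinearMap.smul_apply, hu y, mul_smul_comm] }
  have hS : S = ⊤ := by
    refine eq_top_of_ι_mul_mem S (fun y => ?_) fun y' u hu y => ?_
    · rw [act_one, hA, mul_one]
    · rw [act_ι_mul, hu y, ← LieSubalgebra.coe_bracket, hu, LieHom.map_lie,
        LieRing.of_associative_ring_bracket]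
      noncomm_ring
  have hu : u ∈ S := hS ▸ Submodule.mem_top
  exact hu y

/-- If the kernel of the projection `p` onto `A` is closed under the bracket, `act` is a
representation of `L`: the module induced from the trivial module of that kernel. -/
theorem act_lie (hA : ∀ a : A, p a = a) (hB : ∀ x y : L, p ⁅x - p x, y - p y⁆ = 0) (x y : L)
    (u : UniversalEnvelopingAlgebra ℂ A) :
    act p u ⁅x, y⁆ = act p (act p u y) x - act p (act p u x) y := by
  let S : Submodule ℂ (UniversalEnvelopingAlgebra ℂ A) :=
    { carrier := {u | ∀ x y : L, act p u ⁅x, y⁆ = act p (act p u y) x - act p (act p u x) y}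
      add_mem' := fun {u w} hu hw x y => by
        simp only [map_add, LinearMap.add_apply, hu x y, hw x y]; abel
      zero_mem' := fun x y => by simp
      smul_mem' := fun c u hu x y => by
        simp only [map_smul, LinearMap.smul_apply, hu x y, smul_sub] }
  have hS : S = ⊤ := by
    refine eq_top_of_ι_mul_mem S (fun x y => ?_) fun z u hu x y => ?_
    · have h₁ : ∀ x y : L, act p (act p 1 y) x = ι ℂ (p y) * ι ℂ (p x) + ι ℂ (p ⁅x, (p y : L)⁆) :=
        fun x y => by
          rw [act_one, ← mul_one (ι ℂ (p y)), act_ι_mul, act_one, act_one, mul_one]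
      have h₂ : p ⁅x, y⁆ = p ⁅x, (p y : L)⁆ - p ⁅y, (p x : L)⁆ - ⁅p x, p y⁆ := by
        have h := hB x y
        have h₃ : p ⁅(p x : L), (p y : L)⁆ = ⁅p x, p y⁆ := by
          rw [← LieSubalgebra.coe_bracket, hA]
        rw [sub_lie, lie_sub, lie_sub, map_sub, map_sub, map_sub, h₃,
          ← lie_skew (p x : L) y, map_neg] at h
        rw [← sub_eq_zero, ← h]
        abel
      rw [h₁, h₁, act_one, h₂, map_sub, map_sub, LieHom.map_lie,
        LieRing.of_associative_ring_bracket]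
      abel
    · replace hu : ∀ x y : L, act p u ⁅x, y⁆ = act p (act p u y) x - act p (act p u x) y := hu
      have hj : ⁅⁅x, y⁆, (z : L)⁆ = ⁅x, ⁅y, (z : L)⁆⁆ - ⁅y, ⁅x, (z : L)⁆⁆ := lie_lie x y (z : L)
      simp only [act_ι_mul, hu x y, map_add, LinearMap.add_apply, hj, map_sub, mul_sub, hu]
      abel
  have hu : u ∈ S := hS ▸ Submodule.mem_top
  exact hu x y

section Derivation

variable {p}

/-- The Lie homomorphism `y ↦ ((u, w) ↦ (y u, y w + ∂y u))` extending a derivation `∂` of `A`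
to `U(A)`. -/
noncomputable def derivRep {A : Type*} [LieRing A] [LieAlgebra ℂ A] (d : A →ₗ[ℂ] A)
    (hd : ∀ x y, d ⁅x, y⁆ = ⁅d x, y⁆ + ⁅x, d y⁆) :
    A →ₗ⁅ℂ⁆ Module.End ℂ (UniversalEnvelopingAlgebra ℂ A × UniversalEnvelopingAlgebra ℂ A) where
  toFun y :=
    { toFun := fun u => (ι ℂ y * u.1, ι ℂ y * u.2 + ι ℂ (d y) * u.1)
      map_add' := fun u w => by ext <;> simp [mul_add]; abel
      map_smul' := fun c u => by ext <;> simp }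
  map_add' x y := LinearMap.ext fun u => by ext <;> simp [add_mul]; abel
  map_smul' c x := LinearMap.ext fun u => by ext <;> simp
  map_lie' {x y} := LinearMap.ext fun u => by
    change (ι ℂ ⁅x, y⁆ * u.1, ι ℂ ⁅x, y⁆ * u.2 + ι ℂ (d ⁅x, y⁆) * u.1) =
      (ι ℂ x * (ι ℂ y * u.1), ι ℂ x * (ι ℂ y * u.2 + ι ℂ (d y) * u.1)
        + ι ℂ (d x) * (ι ℂ y * u.1)) -
      (ι ℂ y * (ι ℂ x * u.1), ι ℂ y * (ι ℂ x * u.2 + ι ℂ (d x) * u.1)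
        + ι ℂ (d y) * (ι ℂ x * u.1))
    simp only [hd, map_add, LieHom.map_lie, LieRing.of_associative_ring_bracket, Prod.mk_sub_mk]
    congr 1 <;> noncomm_ring

/-- The extension of a derivation of a Lie algebra to its universal enveloping algebra. -/
noncomputable def deriv {A : Type*} [LieRing A] [LieAlgebra ℂ A] (d : A →ₗ[ℂ] A)
    (hd : ∀ x y, d ⁅x, y⁆ = ⁅d x, y⁆ + ⁅x, d y⁆) :
    Module.End ℂ (UniversalEnvelopingAlgebra ℂ A) :=
  LinearMap.snd ℂ _ _ ∘ₗ LinearMap.applyₗ (1, 0) ∘ₗ (lift ℂ (derivRep d hd)).toLinearMap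

theorem deriv_one {A : Type*} [LieRing A] [LieAlgebra ℂ A] (d : A →ₗ[ℂ] A)
    (hd : ∀ x y, d ⁅x, y⁆ = ⁅d x, y⁆ + ⁅x, d y⁆) : deriv d hd 1 = 0 := by
  simp [deriv]

theorem deriv_ι_mul {A : Type*} [LieRing A] [LieAlgebra ℂ A] (d : A →ₗ[ℂ] A)
    (hd : ∀ x y, d ⁅x, y⁆ = ⁅d x, y⁆ + ⁅x, d y⁆) (y : A) (u : UniversalEnvelopingAlgebra ℂ A) :
    deriv d hd (ι ℂ y * u) = ι ℂ y * deriv d hd u + ι ℂ (d y) * u := by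
  have h : ∀ (y : A) (u : UniversalEnvelopingAlgebra ℂ A), lift ℂ (derivRep d hd) (ι ℂ y * u) =
      derivRep d hd y * lift ℂ (derivRep d hd) u := fun y u => by rw [map_mul, lift_ι_apply]
  have h₁ : ∀ u, (lift ℂ (derivRep d hd) u (1, 0)).1 = u := fun u => by
    have hS := eq_top_of_ι_mul_mem (LinearMap.eqLocus (LinearMap.fst ℂ _ _ ∘ₗ
      LinearMap.applyₗ (1, 0) ∘ₗ (lift ℂ (derivRep d hd)).toLinearMap) LinearMap.id)
      (by simp) (fun y u hu => by
        simp only [LinearMap.mem_eqLocus, LinearMap.comp_apply, AlgHom.toLinearMap_apply, h,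
          LinearMap.id_apply] at hu ⊢
        exact congrArg (ι ℂ y * ·) hu)
    have hu : u ∈ (⊤ : Submodule ℂ _) := Submodule.mem_top
    rw [← hS] at hu
    exact hu
  simp only [deriv, LinearMap.comp_apply, AlgHom.toLinearMap_apply, h]
  change ι ℂ y * _ + ι ℂ (d y) * (lift ℂ (derivRep d hd) u (1, 0)).1 = _
  rw [h₁]
  rfl

/-- A derivation of `L` commuting with `p` acts on the induced module. -/
theorem deriv_act (δ : L →ₗ[ℂ] L) (hδ : ∀ x y, δ ⁅x, y⁆ = ⁅δ x, y⁆ + ⁅x, δ y⁆)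
    (d : A →ₗ[ℂ] A) (hd : ∀ x y, d ⁅x, y⁆ = ⁅d x, y⁆ + ⁅x, d y⁆)
    (hdδ : ∀ y : A, (d y : L) = δ y) (hp : ∀ x, p (δ x) = d (p x)) (x : L)
    (u : UniversalEnvelopingAlgebra ℂ A) :
    deriv d hd (act p u x) = act p (deriv d hd u) x + act p u (δ x) := by
  let S : Submodule ℂ (UniversalEnvelopingAlgebra ℂ A) :=
    { carrier := {u | ∀ x, deriv d hd (act p u x) = act p (deriv d hd u) x + act p u (δ x)}
      add_mem' := fun {u w} hu hw x => by
        simp only [map_add, LinearMap.add_apply, hu x, hw x]; abel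
      zero_mem' := fun x => by simp
      smul_mem' := fun c u hu x => by
        simp only [map_smul, LinearMap.smul_apply, hu x, smul_add] }
  have hS : S = ⊤ := by
    refine eq_top_of_ι_mul_mem S (fun x => ?_) fun y u hu x => ?_
    · rw [deriv_one, act_one, act_one, ← mul_one (ι ℂ (p x)), deriv_ι_mul, deriv_one, hp]
      simp
    · replace hu : ∀ x, deriv d hd (act p u x) = act p (deriv d hd u) x + act p u (δ x) := hu
      simp only [act_ι_mul, deriv_ι_mul, map_add, LinearMap.add_apply, hu, hdδ, hδ, mul_add]
      abel
  have hu : u ∈ S := hS ▸ Submodule.mem_top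
  exact hu x

end Derivation

end InducedModule

/-! ### The vacuum module of the loop algebra -/

namespace Loop

attribute [local instance] LieRing.ofAssociativeRing

open UniversalEnvelopingAlgebra LieAlgebra InducedModule
open scoped TensorProduct

variable {𝔤 : Type*} [LieRing 𝔤] [LieAlgebra ℂ 𝔤]

variable (𝔤) in
/-- The loop algebra `𝔤[t, t⁻¹]`. -/
def LoopAlg : Type _ := loopAlgebra ℂ ℤ 𝔤

noncomputable instance : LieRing (LoopAlg 𝔤) := inferInstanceAs (LieRing (loopAlgebra ℂ ℤ 𝔤))

noncomputable instance : LieAlgebra ℂ (LoopAlg 𝔤) :=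
  inferInstanceAs (LieAlgebra ℂ (loopAlgebra ℂ ℤ 𝔤))

/-- The element `x tⁿ` of the loop algebra `𝔤[t, t⁻¹]`. -/
noncomputable def mono (n : ℤ) : 𝔤 →ₗ[ℂ] LoopAlg 𝔤 :=
  TensorProduct.mk ℂ (AddMonoidAlgebra ℂ ℤ) 𝔤 (AddMonoidAlgebra.single n 1)

theorem mono_lie (m n : ℤ) (x y : 𝔤) : ⁅mono m x, mono n y⁆ = mono (m + n) ⁅x, y⁆ := by
  refine (ExtendScalars.bracket_tmul ℂ (AddMonoidAlgebra ℂ ℤ) 𝔤 𝔤 _ _ _ _).trans ?_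
  rw [AddMonoidAlgebra.single_mul_single, one_mul]
  rfl

variable {W : Type*} [AddCommGroup W] [Module ℂ W]

/-- The linear map on the loop algebra with prescribed values on the elements `x tⁿ`. -/
noncomputable def extend (φ : ℤ → 𝔤 →ₗ[ℂ] W) : LoopAlg 𝔤 →ₗ[ℂ] W :=
  Finsupp.lsum ℂ φ ∘ₗ (LoopAlgebra.toFinsupp ℂ ℤ 𝔤).toLinearMap

theorem extend_mono (φ : ℤ → 𝔤 →ₗ[ℂ] W) (n : ℤ) (x : 𝔤) : extend φ (mono n x) = φ n x := by
  change Finsupp.lsum ℂ φ (LoopAlgebra.toFinsupp ℂ ℤ 𝔤 (AddMonoidAlgebra.single n 1 ⊗ₜ[ℂ] x)) = _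
  rw [LoopAlgebra.toFinsupp_single_tmul]
  simp

theorem eq_top_of_mono_mem (S : Submodule ℂ (LoopAlg 𝔤)) (h : ∀ n x, mono n x ∈ S) :
    S = ⊤ := by
  refine eq_top_iff.2 fun y _ => ?_
  obtain ⟨F, rfl⟩ := (LoopAlgebra.toFinsupp ℂ ℤ 𝔤).symm.surjective y
  induction F using Finsupp.induction_linear with
  | zero => rw [map_zero]; exact S.zero_mem
  | add F G hF hG => rw [map_add]; exact S.add_mem (hF trivial) (hG trivial)
  | single n x => rw [LoopAlgebra.toFinsupp_symm_single]; exact h n x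

theorem hom_ext {φ ψ : LoopAlg 𝔤 →ₗ[ℂ] W} (h : ∀ n x, φ (mono n x) = ψ (mono n x)) :
    φ = ψ :=
  LinearMap.eqLocus_eq_top.1 (eq_top_of_mono_mem _ h)

theorem hom_ext₂ {φ ψ : LoopAlg 𝔤 →ₗ[ℂ] LoopAlg 𝔤 →ₗ[ℂ] W}
    (h : ∀ m x n y, φ (mono m x) (mono n y) = ψ (mono m x) (mono n y)) : φ = ψ :=
  hom_ext fun m x => hom_ext fun n y => h m x n y

/-- The bracket as a bilinear map. -/
noncomputable def bracket :
    LoopAlg 𝔤 →ₗ[ℂ] LoopAlg 𝔤 →ₗ[ℂ] LoopAlg 𝔤 :=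
  LinearMap.mk₂ ℂ (fun x y => ⁅x, y⁆) add_lie smul_lie lie_add (fun c x y => lie_smul c x y)

theorem bracket_mono (m n : ℤ) (x y : 𝔤) : bracket (mono m x) (mono n y) = mono (m + n) ⁅x, y⁆ :=
  mono_lie m n x y

variable (𝔤) in
/-- The projection of `𝔤[t, t⁻¹]` onto `t⁻¹𝔤[t⁻¹]` along `𝔤[t]`. -/
noncomputable def truncate : LoopAlg 𝔤 →ₗ[ℂ] LoopAlg 𝔤 :=
  extend fun n => if n < 0 then mono n else 0

theorem truncate_mono (n : ℤ) (x : 𝔤) :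
    truncate 𝔤 (mono n x) = if n < 0 then mono n x else 0 := by
  rw [truncate, extend_mono]
  split_ifs <;> rfl

theorem truncate_truncate (x : LoopAlg 𝔤) : truncate 𝔤 (truncate 𝔤 x) = truncate 𝔤 x := by
  have h : truncate 𝔤 ∘ₗ truncate 𝔤 = truncate 𝔤 := hom_ext fun n x => by
    rw [LinearMap.comp_apply, truncate_mono]
    split_ifs with h
    · rw [truncate_mono, if_pos h]
    · exact map_zero _
  exact LinearMap.congr_fun h x

theorem truncate_lie_truncate (x y : LoopAlg 𝔤) :
    truncate 𝔤 ⁅truncate 𝔤 x, truncate 𝔤 y⁆ = ⁅truncate 𝔤 x, truncate 𝔤 y⁆ := by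
  have h : (bracket.compl₁₂ (truncate 𝔤) (truncate 𝔤)).compr₂ (truncate 𝔤) =
      bracket.compl₁₂ (truncate 𝔤) (truncate 𝔤) := hom_ext₂ fun m x n y => by
    simp only [LinearMap.compr₂_apply, LinearMap.compl₁₂_apply, truncate_mono]
    split_ifs with hm hn
    · rw [bracket_mono, truncate_mono, if_pos (by omega)]
    all_goals simp
  exact LinearMap.congr_fun₂ h x y

theorem truncate_lie_sub_truncate (x y : LoopAlg 𝔤) :
    truncate 𝔤 ⁅x - truncate 𝔤 x, y - truncate 𝔤 y⁆ = 0 := by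
  have h : (bracket.compl₁₂ (LinearMap.id - truncate 𝔤) (LinearMap.id - truncate 𝔤)).compr₂
      (truncate 𝔤) = 0 := hom_ext₂ fun m x n y => by
    simp only [LinearMap.compr₂_apply, LinearMap.compl₁₂_apply, LinearMap.sub_apply,
      LinearMap.id_apply, truncate_mono, LinearMap.zero_apply]
    split_ifs with hm hn
    any_goals simp
    rw [bracket_mono, truncate_mono, if_neg (by omega)]
  exact LinearMap.congr_fun₂ h x y

variable (𝔤) in
/-- The Lie algebra `t⁻¹𝔤[t⁻¹]`. -/
noncomputable def negative : LieSubalgebra ℂ (LoopAlg 𝔤) :=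
  { LinearMap.eqLocus (truncate 𝔤) LinearMap.id with
    lie_mem' := fun {x y} hx hy => by
      replace hx : truncate 𝔤 x = x := hx
      replace hy : truncate 𝔤 y = y := hy
      change truncate 𝔤 ⁅x, y⁆ = ⁅x, y⁆
      rw [← hx, ← hy, truncate_lie_truncate] }

variable (𝔤) in
/-- The projection onto `t⁻¹𝔤[t⁻¹]`. -/
noncomputable def proj : LoopAlg 𝔤 →ₗ[ℂ] negative 𝔤 :=
  (truncate 𝔤).codRestrict (negative 𝔤).toSubmodule truncate_truncate

theorem proj_coe (a : negative 𝔤) : proj 𝔤 a = a := Subtype.ext a.2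

theorem proj_lie (x y : LoopAlg 𝔤) : proj 𝔤 ⁅x - proj 𝔤 x, y - proj 𝔤 y⁆ = 0 :=
  Subtype.ext (truncate_lie_sub_truncate x y)

theorem proj_mono_of_nonneg {n : ℤ} (hn : 0 ≤ n) (x : 𝔤) : proj 𝔤 (mono n x) = 0 :=
  Subtype.ext ((truncate_mono n x).trans (if_neg (by omega)))

variable (𝔤) in
/-- The derivation `-d/dt` of `𝔤[t, t⁻¹]`. -/
noncomputable def ddt : LoopAlg 𝔤 →ₗ[ℂ] LoopAlg 𝔤 :=
  extend fun n => (-(n : ℂ)) • mono (n - 1)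

theorem ddt_mono (n : ℤ) (x : 𝔤) : ddt 𝔤 (mono n x) = (-(n : ℂ)) • mono (n - 1) x :=
  extend_mono _ n x

theorem ddt_lie (x y : LoopAlg 𝔤) : ddt 𝔤 ⁅x, y⁆ = ⁅ddt 𝔤 x, y⁆ + ⁅x, ddt 𝔤 y⁆ := by
  have h : bracket.compr₂ (ddt 𝔤) = bracket.compl₁₂ (ddt 𝔤) LinearMap.id +
      bracket.compl₁₂ LinearMap.id (ddt 𝔤) := hom_ext₂ fun m x n y => by
    simp only [LinearMap.compr₂_apply, LinearMap.compl₁₂_apply, LinearMap.add_apply,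
      LinearMap.id_apply, ddt_mono, map_smul, LinearMap.smul_apply, bracket_mono]
    rw [show m - 1 + n = m + n - 1 by ring, show m + (n - 1) = m + n - 1 by ring]
    push_cast
    module
  exact LinearMap.congr_fun₂ h x y

theorem truncate_ddt (x : LoopAlg 𝔤) : truncate 𝔤 (ddt 𝔤 x) = ddt 𝔤 (truncate 𝔤 x) := by
  have h : truncate 𝔤 ∘ₗ ddt 𝔤 = ddt 𝔤 ∘ₗ truncate 𝔤 := hom_ext fun n x => by
    simp only [LinearMap.comp_apply, ddt_mono, truncate_mono, map_smul]
    -- `t⁰` is sent to `0`, so the constants do not leak into `t⁻¹𝔤[t⁻¹]`.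
    rcases lt_trichotomy n 0 with hn | rfl | hn
    · rw [if_pos (by omega), if_pos hn, ddt_mono]
    · simp
    · rw [if_neg (by omega), if_neg (by omega), smul_zero, map_zero]
  exact LinearMap.congr_fun h x

variable (𝔤) in
/-- The derivation `-d/dt` of `t⁻¹𝔤[t⁻¹]`. -/
noncomputable def negDdt : negative 𝔤 →ₗ[ℂ] negative 𝔤 :=
  (ddt 𝔤).restrict (p := (negative 𝔤).toSubmodule) (q := (negative 𝔤).toSubmodule)
    fun x hx => by
      replace hx : truncate 𝔤 x = x := hx
      change truncate 𝔤 (ddt 𝔤 x) = ddt 𝔤 x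
      rw [truncate_ddt, hx]

theorem negDdt_lie (x y : negative 𝔤) : negDdt 𝔤 ⁅x, y⁆ = ⁅negDdt 𝔤 x, y⁆ + ⁅x, negDdt 𝔤 y⁆ :=
  Subtype.ext (ddt_lie (x : LoopAlg 𝔤) y)

theorem proj_ddt (x : LoopAlg 𝔤) : proj 𝔤 (ddt 𝔤 x) = negDdt 𝔤 (proj 𝔤 x) :=
  Subtype.ext (truncate_ddt x)

variable (𝔤) in
/-- The vacuum module of level zero: `U(t⁻¹𝔤[t⁻¹])`, the module of the loop algebra induced from
the trivial module of `𝔤[t]`. -/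
abbrev Vacuum : Type _ := UniversalEnvelopingAlgebra ℂ (negative 𝔤)

/-- The action of `x tⁿ` on the vacuum module. -/
noncomputable def mode (n : ℤ) (x : 𝔤) : Module.End ℂ (Vacuum 𝔤) :=
  (act (proj 𝔤)).flip (mono n x)

theorem mode_apply (n : ℤ) (x : 𝔤) (u : Vacuum 𝔤) : mode n x u = act (proj 𝔤) u (mono n x) := rfl

theorem mode_one (n : ℤ) (x : 𝔤) (hn : 0 ≤ n) : mode n x 1 = 0 := by
  rw [mode_apply, act_one, proj_mono_of_nonneg hn, map_zero]

theorem mode_commutator (m n : ℤ) (x y : 𝔤) (u : Vacuum 𝔤) :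
    mode m x (mode n y u) - mode n y (mode m x u) = mode (m + n) ⁅x, y⁆ u := by
  simp only [mode_apply, ← act_lie (proj 𝔤) proj_coe proj_lie, mono_lie]

theorem eventually_mode (x : 𝔤) (u : Vacuum 𝔤) : ∀ᶠ n in atTop, mode n x u = 0 := by
  let S : Submodule ℂ (Vacuum 𝔤) :=
    { carrier := {u | ∀ x, ∀ᶠ n in atTop, mode n x u = 0}
      add_mem' := fun {u w} hu hw x => by
        filter_upwards [hu x, hw x] with n h₁ h₂
        rw [map_add, h₁, h₂, add_zero]
      zero_mem' := fun x => by simp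
      smul_mem' := fun c u hu x => by
        filter_upwards [hu x] with n h
        rw [map_smul, h, smul_zero] }
  have hS : S = ⊤ := by
    refine eq_top_of_ι_mul_mem S (fun x => ?_) fun y u hu x => ?_
    · filter_upwards [eventually_ge_atTop 0] with n hn using mode_one n x hn
    · let R : Submodule ℂ (LoopAlg 𝔤) :=
        { carrier := {y | ∀ᶠ n in atTop, act (proj 𝔤) u ⁅mono n x, y⁆ = 0}
          add_mem' := fun {y z} hy hz => by
            filter_upwards [hy, hz] with n h₁ h₂
            rw [lie_add, map_add, h₁, h₂, add_zero]
          zero_mem' := by simp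
          smul_mem' := fun c y hy => by
            filter_upwards [hy] with n h
            rw [lie_smul, map_smul, h, smul_zero] }
      have hR : R = ⊤ := eq_top_of_mono_mem R fun m y => by
        have h := (tendsto_atTop_add_const_right atTop m tendsto_id).eventually (hu ⁅x, y⁆)
        filter_upwards [h] with n hn
        rw [mono_lie]
        exact hn
      have hy : (y : LoopAlg 𝔤) ∈ R := hR ▸ Submodule.mem_top
      filter_upwards [hu x, hy] with n h₁ h₂
      rw [mode_apply] at h₁ ⊢
      rw [act_ι_mul, h₁, h₂, mul_zero, add_zero]
  have hu : u ∈ S := hS ▸ Submodule.mem_top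
  exact hu x

variable (𝔤) in
/-- The translation operator on the vacuum module. -/
noncomputable def translation : Module.End ℂ (Vacuum 𝔤) := deriv (negDdt 𝔤) negDdt_lie

theorem translation_mode (n : ℤ) (x : 𝔤) (u : Vacuum 𝔤) :
    translation 𝔤 (mode n x u) = mode n x (translation 𝔤 u) - (n : ℂ) • mode (n - 1) x u := by
  simp only [mode_apply, translation]
  rw [deriv_act (ddt 𝔤) ddt_lie (negDdt 𝔤) negDdt_lie (fun _ => rfl) proj_ddt, ddt_mono, map_smul,
    neg_smul, ← sub_eq_add_neg]

/-- The current `x(z) = ∑ₙ (x tⁿ) z⁻ⁿ⁻¹`. -/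
noncomputable def current : 𝔤 →ₗ[ℂ] FieldOn (Vacuum 𝔤) where
  toFun x := ⟨fun n => mode n x, eventually_mode x⟩
  map_add' x y := by ext n u; simp [mode_apply]
  map_smul' c x := by ext n u; simp [mode_apply]

/-- The identity field. -/
noncomputable def oneField (V : Type*) [AddCommGroup V] [Module ℂ V] : FieldOn V :=
  ⟨fun n => if n = -1 then 1 else 0, fun v => by
    filter_upwards [eventually_ge_atTop 0] with n hn
    rw [if_neg (by omega), LinearMap.zero_apply]⟩

theorem oneField_apply {V : Type*} [AddCommGroup V] [Module ℂ V] (n : ℤ) (x : V) :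
    (oneField V).1 n x = if n = -1 then x else 0 := by
  change (if n = -1 then (1 : Module.End ℂ V) else 0) x = _
  split_ifs <;> rfl

variable (𝔤) in
/-- The fields `x(z) + c` attached to the vectors of `𝔤 ⊕ ℂ`. -/
noncomputable def fields : (SoupedUpLieAlgebra.trivial 𝔤).Carrier →ₗ[ℂ] FieldOn (Vacuum 𝔤) :=
  LinearMap.coprod (M := 𝔤) (M₂ := ℂ) current (LinearMap.toSpanSingleton ℂ _ (oneField (Vacuum 𝔤)))

theorem fields_eq (s : (SoupedUpLieAlgebra.trivial 𝔤).Carrier) :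
    fields 𝔤 s = current s.1 + s.2 • oneField (Vacuum 𝔤) := rfl

theorem fields_apply (s : (SoupedUpLieAlgebra.trivial 𝔤).Carrier) (n : ℤ) (u : Vacuum 𝔤) :
    (fields 𝔤 s).1 n u = mode n s.1 u + s.2 • if n = -1 then u else 0 := by
  rw [← oneField_apply]; rfl

theorem isLocal_oneField (a : FieldOn (Vacuum 𝔤)) : FieldOn.IsLocal (oneField (Vacuum 𝔤)) a := by
  refine ⟨0, fun u => ?_⟩
  ext p q
  simp only [pow_zero, Module.End.one_apply, FieldOn.commutator, oneField_apply]
  split_ifs <;> simp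

theorem isLocal_current (x y : 𝔤) : FieldOn.IsLocal (current x) (current y) := by
  refine ⟨1, fun u => ?_⟩
  have h : FieldOn.commutator (current x) (current y) u =
      fun p q => mode (p + q) ⁅x, y⁆ u := by
    ext p q; exact mode_commutator p q x y u
  ext p q
  rw [pow_one, h, diff_apply, show p + 1 + q = p + (q + 1) by ring, sub_self]
  rfl

theorem isGenerating : FieldOn.IsGenerating (translation 𝔤) (1 : Vacuum 𝔤)
    (SoupedUpLieAlgebra.trivial 𝔤).one (fields 𝔤) where
  translation_vac := deriv_one _ _
  one_apply n u := by
    rw [fields_apply]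
    change mode n (0 : 𝔤) u + (1 : ℂ) • _ = _
    simp [mode_apply]
  isVertexField s := by
    rw [fields_eq]
    refine FieldOn.IsVertexField.add ⟨fun n u => translation_mode n _ u,
      fun n hn => mode_one n _ hn⟩ (FieldOn.IsVertexField.smul _ ⟨fun n u => ?_, fun n hn => ?_⟩)
    · simp only [oneField_apply]
      by_cases h : n = -1
      · rw [if_pos h, if_pos h, if_neg (by omega), smul_zero, sub_zero]
      · rw [if_neg h, if_neg h]
        by_cases h' : n = 0
        · simp [h']
        · rw [if_neg (by omega), map_zero, smul_zero, sub_zero]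
    · rw [oneField_apply, if_neg (by omega)]
  isLocal s t := by
    rw [fields_eq, fields_eq]
    refine FieldOn.IsLocal.add_left (FieldOn.IsLocal.symm ?_)
      ((isLocal_oneField _).smul_left _)
    exact (isLocal_current _ _).add_left ((isLocal_oneField _).smul_left _)
  cyclic S h1 hS := by
    refine eq_top_of_ι_mul_mem S h1 fun y u hu => ?_
    rw [← act_coe (proj 𝔤) proj_coe]
    have h := eq_top_of_mono_mem (S.comap (act (proj 𝔤) u)) fun n x => by
      have h := hS ((x, 0) : 𝔤 × ℂ) n u hu
      have e := fields_apply ((x, 0) : 𝔤 × ℂ) n u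
      rw [zero_smul, add_zero] at e
      exact (congrArg (· ∈ S) e).mp h
    have hy : (y : LoopAlg 𝔤) ∈ S.comap (act (proj 𝔤) u) := h ▸ Submodule.mem_top
    exact hy

theorem state_fields (s : (SoupedUpLieAlgebra.trivial 𝔤).Carrier) :
    FieldOn.state (1 : Vacuum 𝔤) (fields 𝔤 s) = mode (-1) s.1 1 + s.2 • (1 : Vacuum 𝔤) := by
  change (fields 𝔤 s).1 (-1) 1 = _
  rw [fields_apply, if_pos rfl]

/-- The nonnegative products of the generating fields, on states: `s₀t = [s,t]` and `sₙt = 0` for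
`n ≥ 1`. -/
theorem fields_apply_state (s t : (SoupedUpLieAlgebra.trivial 𝔤).Carrier) (n : ℤ) (hn : 0 ≤ n) :
    (fields 𝔤 s).1 n (FieldOn.state (1 : Vacuum 𝔤) (fields 𝔤 t)) =
      mode (n - 1) ⁅s.1, t.1⁆ (1 : Vacuum 𝔤) := by
  have h := mode_commutator n (-1) s.1 t.1 (1 : Vacuum 𝔤)
  rw [mode_one n s.1 hn, map_zero, sub_zero] at h
  rw [fields_apply, state_fields, if_neg (by omega), smul_zero, add_zero, map_add, map_smul, h,
    mode_one n s.1 hn, smul_zero, add_zero]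
  rfl

/-- The character of `t⁻¹𝔤[t⁻¹]` given on `t⁻¹𝔤` by a linear form on `𝔤`; the brackets lie in
`t⁻²𝔤[t⁻¹]`, where it vanishes. -/
noncomputable def character (l : 𝔤 →ₗ[ℂ] ℂ) : negative 𝔤 →ₗ⁅ℂ⁆ ℂ :=
  { (extend fun n => if n = -1 then l else 0) ∘ₗ (negative 𝔤).toSubmodule.subtype with
    map_lie' := fun {x y} => by
      have h : (bracket.compl₁₂ (truncate 𝔤) (truncate 𝔤)).compr₂
          (extend fun n => if n = -1 then l else 0) = 0 := hom_ext₂ fun m x n y => by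
        simp only [LinearMap.compr₂_apply, LinearMap.compl₁₂_apply, truncate_mono]
        split_ifs with hm hn
        · rw [bracket_mono, extend_mono, if_neg (by omega)]; simp
        all_goals simp
      have hx : truncate 𝔤 (x : LoopAlg 𝔤) = x := x.2
      have hy : truncate 𝔤 (y : LoopAlg 𝔤) = y := y.2
      have h' := LinearMap.congr_fun₂ h (x : LoopAlg 𝔤) y
      rw [LinearMap.compr₂_apply, LinearMap.compl₁₂_apply, hx, hy] at h'
      rw [LieRing.of_associative_ring_bracket, mul_comm, sub_self]
      exact h' }

theorem lift_character_mode (l : 𝔤 →ₗ[ℂ] ℂ) (x : 𝔤) :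
    lift ℂ (character l) (mode (-1) x (1 : Vacuum 𝔤)) = l x := by
  rw [mode_apply, act_one, lift_ι_apply]
  change extend (fun n => if n = -1 then l else 0) (truncate 𝔤 (mono (-1) x)) = l x
  rw [truncate_mono, if_pos (by norm_num), extend_mono, if_pos rfl]

theorem fields_injective : Function.Injective (fields 𝔤) := by
  refine (injective_iff_map_eq_zero _).2 fun s hs => ?_
  have h := state_fields s
  rw [hs, map_zero] at h
  have hl : ∀ l : 𝔤 →ₗ[ℂ] ℂ, l s.1 + s.2 = 0 := fun l => by
    have h' := congrArg (lift ℂ (character l)) h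
    rw [map_zero, map_add, lift_character_mode, map_smul, map_one, smul_eq_mul, mul_one] at h'
    exact h'.symm
  have h₂ : s.2 = 0 := by simpa using hl 0
  have h₁ : s.1 = 0 := (Module.forall_dual_apply_eq_zero_iff ℂ s.1).1 fun l => by
    simpa [h₂] using hl l
  exact Prod.ext h₁ h₂

end Loop

/-! ### The two ideals of relations -/

namespace IFA.ContainsVertexRelations

variable {v : Type*} [AddCommGroup v] [Module ℂ v] {e : v} {N : v → v → ℕ} {M : ℕ}
  {J : Submodule ℂ (IFA v)}

open IFA

theorem one_mul_neg_two_mem (h : ContainsVertexRelations e N M J) (x : IFA v) :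
    mul (-2) (ι e) x ∈ J := by
  have h₁ := h.identity x (-1) (Or.inl rfl)
  have h₂ := h.identity (D e x) (-1) (Or.inl rfl)
  have h₃ := h.derivation (ι e) x (-1) (Or.inl rfl)
  have h₄ := h.translation (ι e) x (-1)
  rw [if_pos (by norm_num)] at h₁ h₂
  have h₅ : D e (mul (-1) (ι e) x - x) ∈ J := (h.isIdeal (-2) (ι e) _ h₁).2
  rw [map_sub] at h₅
  have e : mul (-2) (ι e) x = D e (mul (-1) (ι e) x) - D e x
      - (D e (mul (-1) (ι e) x) - mul (-1) (D e (ι e)) x - mul (-1) (ι e) (D e x))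
      - (mul (-1) (ι e) (D e x) - D e x)
      - (mul (-1) (D e (ι e)) x + ((-1 : ℤ) : ℂ) • mul (-1 - 1) (ι e) x) := by
    rw [show (-1 : ℤ) - 1 = -2 by norm_num]
    push_cast
    module
  rw [e]
  exact J.sub_mem (J.sub_mem (J.sub_mem h₅ h₃) h₂) h₄

/-- All products `𝟏ₙx` with `n ≠ -1` vanish, also for the indices on which the identity relation
is not imposed: `D𝟏` vanishes and `(D𝟏)ₙ₊₁x = -(n + 1) 𝟏ₙx`. -/
theorem one_mul_mem (h : ContainsVertexRelations e N M J) {n : ℤ} (hn : n ≠ -1) (x : IFA v) :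
    mul n (ι e) x ∈ J := by
  have h₁ : D e (ι e) ∈ J := h.one_mul_neg_two_mem (ι e)
  have h₂ := h.translation (ι e) x (n + 1)
  rw [J.add_mem_iff_right (h.isIdeal _ x _ h₁).2, add_sub_cancel_right] at h₂
  exact (J.smul_mem_iff (by exact_mod_cast fun h => hn (by omega))).1 h₂

/-- Iterating `(Dx)ₙy = -n xₙ₋₁y`: for `n ≥ 0` the coefficient relating `(Dʲx)ₙ₊ⱼy` to `xₙy` does
not vanish. -/
theorem translation_pow (h : ContainsVertexRelations e N M J) (x y : IFA v) (n : ℤ) (hn : 0 ≤ n)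
    (j : ℕ) (hj : mul (n + j) ((D e ^ j) x) y ∈ J) : mul n x y ∈ J := by
  induction j with
  | zero => simpa using hj
  | succ j ih =>
    apply ih
    have h₂ := h.translation ((D e ^ j) x) y (n + (j + 1 : ℕ))
    rw [pow_succ', Module.End.mul_apply] at hj
    rw [J.add_mem_iff_right hj, show n + ((j + 1 : ℕ) : ℤ) - 1 = n + j by push_cast; ring] at h₂
    refine (J.smul_mem_iff ?_).1 h₂
    have : (n + (j + 1 : ℕ) : ℤ) ≠ 0 := by omega
    exact_mod_cast this

/-- All products `xₙ𝟏` with `n ≥ 0` vanish: raising `n` by derivatives of `x` one reaches the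
indices where quasi-commutativity is imposed. -/
theorem mul_one_mem (h : ContainsVertexRelations e N M J) {n : ℤ} (hn : 0 ≤ n) (x : IFA v) :
    mul n x (ι e) ∈ J := by
  refine h.translation_pow x (ι e) n hn M ?_
  have hs := h.quasiComm ((D e ^ M) x) (ι e) (n + M) (Or.inr (by omega)) 0 fun k _ => by
    have h0 : ∀ (k : ℕ) (z : IFA v), z ∈ J → (D e ^ k) z ∈ J := fun k => by
      induction k with
      | zero => exact fun z hz => hz
      | succ k ih =>
        intro z hz
        rw [pow_succ', Module.End.mul_apply]
        exact (h.isIdeal (-2) (ι e) _ (ih z hz)).2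
    exact J.smul_mem _ (h0 k _ (h.one_mul_mem (by omega) _))
  simpa using hs

end IFA.ContainsVertexRelations

namespace SoupedUpLieAlgebra

open IFA

variable {𝔤 : Type*} [LieRing 𝔤] [LieAlgebra ℂ 𝔤] {M : ℕ}
  {J : Submodule ℂ (IFA (trivial 𝔤).Carrier)}

theorem eq_inG_add_smul_one (s : (trivial 𝔤).Carrier) :
    s = (trivial 𝔤).inG s.1 + (s.2 : ℂ) • (trivial 𝔤).one :=
  Prod.ext (by
    change s.1 = s.1 + s.2 • (0 : 𝔤)
    simp) (by
    change s.2 = 0 + s.2 • (1 : ℂ)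
    simp)

theorem inA_eq (a : ℂ) : (trivial 𝔤).inA a = a • (trivial 𝔤).one :=
  Prod.ext (by change (0 : 𝔤) = a • (0 : 𝔤); simp) (by change a = a • (1 : ℂ); simp)

theorem trivial_lie (s t : (trivial 𝔤).Carrier) : ⁅s, t⁆ = (trivial 𝔤).inG ⁅s.1, t.1⁆ :=
  Prod.ext rfl (sub_self (0 : ℂ))

theorem trivial_leftMul (a : ℂ) (s : (trivial 𝔤).Carrier) : (trivial 𝔤).leftMul a s = a • s := rfl

theorem ContainsRelations.toCurrent (h : (trivial 𝔤).ContainsRelations (fun _ _ => 1) M J) :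
    ContainsCurrentRelations (0 : LinearMap.BilinForm ℂ 𝔤) M J where
  isIdeal := h.isIdeal
  identity := h.identity
  locality u w n hn := h.locality u w n (le_trans (by norm_num) hn)
  derivation := h.derivation
  translation := h.translation
  quasiComm := h.quasiComm
  quasiAssoc := h.quasiAssoc
  zeroth x y := by
    have h₁ := h.lie ((trivial 𝔤).inG x) ((trivial 𝔤).inG y)
    rwa [trivial_lie] at h₁
  first x y := by
    have h₁ := h.locality ((trivial 𝔤).inG x) ((trivial 𝔤).inG y) 1 (by norm_num)
    simpa using h₁

/-- The components along `𝟏` do not contribute to the products of nonnegative index. -/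
theorem _root_.ContainsCurrentRelations.mul_sub_mem
    (h : ContainsCurrentRelations (0 : LinearMap.BilinForm ℂ 𝔤) M J) {n : ℤ} (hn : 0 ≤ n)
    (s t : (trivial 𝔤).Carrier) : mul n (ι s) (ι t) -
      mul n (ι ((trivial 𝔤).inG s.1)) (ι ((trivial 𝔤).inG t.1)) ∈ J := by
  have h₁ := h.one_mul_mem (n := n) (by omega) (ι t)
  have h₂ := h.mul_one_mem hn (ι ((trivial 𝔤).inG s.1))
  have e : mul n (ι s) (ι t) - mul n (ι ((trivial 𝔤).inG s.1)) (ι ((trivial 𝔤).inG t.1)) =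
      (t.2 : ℂ) • mul n (ι ((trivial 𝔤).inG s.1)) (ι (trivial 𝔤).one) +
        (s.2 : ℂ) • mul n (ι (trivial 𝔤).one) (ι t) := by
    have hs : ι s = ι ((trivial 𝔤).inG s.1) + (s.2 : ℂ) • ι (trivial 𝔤).one := by
      rw [← map_smul, ← map_add, ← eq_inG_add_smul_one]
    have ht : ι t = ι ((trivial 𝔤).inG t.1) + (t.2 : ℂ) • ι (trivial 𝔤).one := by
      rw [← map_smul, ← map_add, ← eq_inG_add_smul_one]
    rw [hs, ht]
    simp only [map_add, map_smul, LinearMap.add_apply, LinearMap.smul_apply]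
    module
  rw [e]
  exact J.add_mem (J.smul_mem _ h₂) (J.smul_mem _ h₁)

theorem _root_.ContainsCurrentRelations.toContainsRelations
    (h : ContainsCurrentRelations (0 : LinearMap.BilinForm ℂ 𝔤) M J) :
    (trivial 𝔤).ContainsRelations (fun _ _ => 1) M J where
  isIdeal := h.isIdeal
  identity := h.identity
  locality s t n hn := by
    rcases eq_or_lt_of_le hn with hn | hn
    · have h₁ := h.first s.1 t.1
      have h₂ := h.mul_sub_mem (n := 1) (by norm_num) s t
      rw [LinearMap.zero_apply, LinearMap.zero_apply, zero_smul, sub_zero] at h₁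
      rw [← hn]
      simpa using J.add_mem h₂ h₁
    · exact h.locality s t n (by push_cast at hn ⊢; omega)
  derivation := h.derivation
  translation := h.translation
  quasiComm := h.quasiComm
  quasiAssoc := h.quasiAssoc
  lie s t := by
    have h₁ := J.add_mem (h.mul_sub_mem le_rfl s t) (h.zeroth s.1 t.1)
    rwa [sub_add_sub_cancel, ← trivial_lie] at h₁
  leftMul a s := by
    have h₁ := J.smul_mem a (h.identity (ι s) (-1) (Or.inl rfl))
    rw [if_pos (by norm_num), smul_sub] at h₁
    rw [trivial_leftMul, inA_eq, map_smul, map_smul, map_smul]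
    exact h₁
  assoc a b x := by
    have h₁ := J.smul_mem (-(a * b))
      (h.identity (mul (-1) (ι (trivial 𝔤).one) x) (-1) (Or.inl rfl))
    rw [if_pos (by norm_num)] at h₁
    simp only [inA_eq, map_smul, LinearMap.smul_apply]
    convert h₁ using 1
    module

theorem vertexIdeal_eq_currentIdeal (𝔤 : Type*) [LieRing 𝔤] [LieAlgebra ℂ 𝔤] (M : ℕ) :
    (trivial 𝔤).vertexIdeal (fun _ _ => 1) M =
      currentIdeal (0 : LinearMap.BilinForm ℂ 𝔤) M :=
  congrArg sInf (Set.ext fun _ => ⟨fun h => h.toCurrent, fun h => h.toContainsRelations⟩)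

/-- The relations of `V(𝔰)` hold for the fields `x(z) + c` on the vacuum module. -/
theorem containsRelations_ker (𝔤 : Type*) [LieRing 𝔤] [LieAlgebra ℂ 𝔤] (M : ℕ) :
    (trivial 𝔤).ContainsRelations (fun _ _ => 1) M
      (LinearMap.ker (IFA.lift FieldOn.prod (Loop.fields 𝔤))) := by
  refine ContainsCurrentRelations.toContainsRelations
    { Loop.isGenerating.containsVertexRelations _ (fun s t n hn => ?_) M with
      zeroth := fun x y => ?_
      first := fun x y => ?_ }
  · have hn' : (2 : ℤ) ≤ n := hn
    rw [Loop.fields_apply_state _ _ _ (by omega), Loop.mode_one _ _ (by omega)]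
  · rw [Loop.isGenerating.mem_ker_iff, map_sub, map_sub, Loop.isGenerating.state_lift_mul,
      IFA.lift_ι, IFA.lift_ι, IFA.lift_ι, Loop.fields_apply_state _ _ _ le_rfl, Loop.state_fields]
    change _ - (Loop.mode (-1) ⁅x, y⁆ 1 + (0 : ℂ) • 1) = 0
    rw [zero_smul, add_zero]
    exact sub_self _
  · rw [Loop.isGenerating.mem_ker_iff, LinearMap.zero_apply, LinearMap.zero_apply, zero_smul,
      sub_zero, Loop.isGenerating.state_lift_mul]
    exact (Loop.fields_apply_state _ _ _ (by norm_num)).trans (Loop.mode_one _ _ (by norm_num))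

theorem eq_zero_of_ι_mem_vertexIdeal {s : (trivial 𝔤).Carrier}
    (hs : ι s ∈ (trivial 𝔤).vertexIdeal (fun _ _ => 1) M) : s = 0 := by
  have h : ι s ∈ LinearMap.ker (IFA.lift FieldOn.prod (Loop.fields 𝔤)) :=
    (isLeast_vertexIdeal _ _ M).2 (containsRelations_ker 𝔤 M) hs
  rw [LinearMap.mem_ker, IFA.lift_ι] at h
  exact Loop.fields_injective (h.trans (map_zero _).symm)

end SoupedUpLieAlgebra

theorem theorem4p6 (𝔤 : Type*) [LieRing 𝔤] [LieAlgebra ℂ 𝔤] (M : ℕ) :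
    Function.Injective
        ((SoupedUpLieAlgebra.trivial 𝔤).toVertexAlgebra (fun _ _ => 1) M) ∧
      (SoupedUpLieAlgebra.trivial 𝔤).vertexIdeal (fun _ _ => 1) M ⊓
        LinearMap.range (IFA.ι (v := (SoupedUpLieAlgebra.trivial 𝔤).Carrier)) = ⊥ ∧
      (SoupedUpLieAlgebra.trivial 𝔤).vertexIdeal (fun _ _ => 1) M =
        currentIdeal (0 : LinearMap.BilinForm ℂ 𝔤) M := by
  refine ⟨(injective_iff_map_eq_zero _).2 fun s hs => ?_, (Submodule.eq_bot_iff _).2 ?_,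
    SoupedUpLieAlgebra.vertexIdeal_eq_currentIdeal 𝔤 M⟩
  · exact SoupedUpLieAlgebra.eq_zero_of_ι_mem_vertexIdeal ((Submodule.Quotient.mk_eq_zero _).1 hs)
  · rintro _ ⟨hx, s, rfl⟩
    rw [SoupedUpLieAlgebra.eq_zero_of_ι_mem_vertexIdeal hx, map_zero]
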